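/- A 3-graph is a finite vertex set together with a set of 3-element subsets of it, called edges. Let $P_3^3$ be the 3-graph on $7$ vertices $v_1,\dots,v_7$ with edges $\{v_1,v_2,v_3\},\{v_3,v_4,v_5\},\{v_5,v_6,v_7\}$ (the linear path of length 3), let $C_3^3$ be the 3-graph on $6$ vertices $a,b,c,d,e,f$ with edges $\{a,b,c\},\{c,d,e\},\{e,f,a\}$ (the triangle), and let $K_6^3$ be the complete 3-graph on $6$ vertices, with all $20$ triples as edges. A 3-graph is $P_3^3$-free if it has no (not necessarily induced) subhypergraph isomorphic to $P_3^3$. For $m\ge 0$ let $ex_3(m;P_3^3)$ be the largest number of edges in a $P_3^3$-free 3-graph on $m$ vertices (so $ex_3(0;P_3^3)=0$), and for $n\ge 6$ let $ex_3(n;P_3^3|C_3^3)$ be the largest number of edges in a $P_3^3$-free 3-graph on $n$ vertices that contains a copy of $C_3^3$. Then, for every $n\ge 6$, $$ex_3(n;P_3^3|C_3^3)=20+ex_3(n-6;P_3^3).$$ Moreover, up to isomorphism there is a unique $P_3^3$-free 3-graph $G$ on $n-6$ vertices with $ex_3(n-6;P_3^3)$ edges, and a 3-graph $H$ on $n$ vertices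 is $P_3^3$-free, contains a copy of $C_3^3$ and has $ex_3(n;P_3^3|C_3^3)$ edges if and only if $H$ is isomorphic to the union of vertex-disjoint copies of $K_6^3$ and $G$. -/

import Mathlib

/-- A `k`-uniform hypergraph (`k`-graph) whose vertex set is the type `V`: a finite family of
`k`-element subsets of `V`. -/
@[ext]
structure KGraph (k : ℕ) (V : Type*) where
  /-- The edges. -/
  edges : Finset (Finset V)
  /-- Every edge has exactly `k` vertices. -/
  uniform : ∀ e ∈ edges, e.card = k

namespace KGraph

/-- `H.Contains F`: `H` has a (not necessarily induced) subhypergraph isomorphic to `F`. -/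
def Contains {k : ℕ} {V W : Type*} (H : KGraph k V) (F : KGraph k W) : Prop :=
  ∃ f : W ↪ V, ∀ e ∈ F.edges, e.map f ∈ H.edges

/-- `H.Free F`: `H` is `F`-free. -/
def Free {k : ℕ} {V W : Type*} (H : KGraph k V) (F : KGraph k W) : Prop :=
  ¬ H.Contains F

/-- Isomorphism of `k`-graphs. -/
def Isomorphic {k : ℕ} {V W : Type*} (H : KGraph k V) (G : KGraph k W) : Prop :=
  ∃ f : V ≃ W, ∀ e : Finset V, e ∈ H.edges ↔ e.map f.toEmbedding ∈ G.edges

/-- The complete `k`-graph `K_n^k` on `n` vertices. -/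
def complete (k n : ℕ) : KGraph k (Fin n) where
  edges := Finset.powersetCard k Finset.univ
  uniform := fun _ he => (Finset.mem_powersetCard.mp he).2

/-- The union of vertex-disjoint copies of `H` and `G`. -/
def disjointUnion {k : ℕ} {V W : Type*} [DecidableEq V] [DecidableEq W]
    (H : KGraph k V) (G : KGraph k W) : KGraph k (V ⊕ W) where
  edges := H.edges.image (fun e => e.map Function.Embedding.inl) ∪
    G.edges.image (fun e => e.map Function.Embedding.inr)
  uniform := by
    intro e he
    rcases Finset.mem_union.mp he with h | h
    · obtain ⟨a, ha, rfl⟩ := Finset.mem_image.mp h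
      rw [Finset.card_map]
      exact H.uniform a ha
    · obtain ⟨a, ha, rfl⟩ := Finset.mem_image.mp h
      rw [Finset.card_map]
      exact G.uniform a ha

/-- The 3-uniform linear path `P_3^3` of length 3: three edges on seven vertices, consecutive edges
sharing exactly one vertex and the first and the last edge being disjoint. -/
def linearPath3 : KGraph 3 (Fin 7) where
  edges := {{0, 1, 2}, {2, 3, 4}, {4, 5, 6}}
  uniform := by
    intro e he
    simp only [Finset.mem_insert, Finset.mem_singleton] at he
    rcases he with rfl | rfl | rfl <;> rfl

/-- The 3-uniform triangle `C_3^3`, with vertices `a, b, c, d, e, f` and edges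
`{a, b, c}`, `{c, d, e}`, `{e, f, a}`. -/
def triangle3 : KGraph 3 (Fin 6) where
  edges := {{0, 1, 2}, {2, 3, 4}, {4, 5, 0}}
  uniform := by
    intro e he
    simp only [Finset.mem_insert, Finset.mem_singleton] at he
    rcases he with rfl | rfl | rfl <;> rfl

/-- The Turán number `ex_k(n; F)`: the largest number of edges of an `F`-free `k`-graph on `n`
vertices. -/
noncomputable def ex {k : ℕ} {W : Type*} (n : ℕ) (F : KGraph k W) : ℕ :=
  sSup {m : ℕ | ∃ H : KGraph k (Fin n), H.Free F ∧ H.edges.card = m}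

/-- The conditional Turán number `ex_k(n; F | G)`: the largest number of edges of an `F`-free
`k`-graph on `n` vertices that contains `G`. -/
noncomputable def exCond {k : ℕ} {W W' : Type*} (n : ℕ) (F : KGraph k W) (G : KGraph k W') : ℕ :=
  sSup {m : ℕ | ∃ H : KGraph k (Fin n), H.Free F ∧ H.Contains G ∧ H.edges.card = m}

/-- `H` is extremal for `ex_k(n; F)`. -/
def IsExtremal {k n : ℕ} {W : Type*} (H : KGraph k (Fin n)) (F : KGraph k W) : Prop :=
  H.Free F ∧ H.edges.card = ex n F

/-- `H` is extremal for `ex_k(n; F | G)`. -/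
def IsCondExtremal {k n : ℕ} {W W' : Type*} (H : KGraph k (Fin n))
    (F : KGraph k W) (G : KGraph k W') : Prop :=
  H.Free F ∧ H.Contains G ∧ H.edges.card = exCond n F G

/-- The number of edges is bounded, so that the suprema above are over bounded sets. -/
theorem card_edges_le {k n : ℕ} (H : KGraph k (Fin n)) : H.edges.card ≤ n.choose k := by
  have h : H.edges ⊆ Finset.powersetCard k (Finset.univ : Finset (Fin n)) := fun e he =>
    Finset.mem_powersetCard.mpr ⟨Finset.subset_univ e, H.uniform e he⟩
  simpa using Finset.card_le_card h

end KGraph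

/-! Fix a triangle in a path-free 3-graph and let `U` be its six vertices. If every edge lies inside
`U` or misses `U`, there are at most 20 edges inside and at most `ex (n - 6)` outside, and equality
forces a complete graph on `U` and an extremal graph on the rest. It remains to show that an edge
crossing the boundary of `U` is too costly.

A crossing edge has exactly one vertex outside `U`, and its trace on `U` is one of six pairs
(`netPairs`): two corners, or a corner with the opposite midpoint. One crossing edge already limits
the edges inside `U` to 11 (`card_inside_le`). If `Y` is the set of outer endpoints of crossing
edges, at most `3 * max #Y 2` edges cross (`card_crossing_pair_le`), and no edge missing `U` meets
`Y` (`crossing_disjoint`). Since `11 + 3 * max t 2 < 20 + ex t` for `t ≥ 1` (`crossing_bound_lt`)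
and `ex` is superadditive (`ex_add_le`), the total stays below `20 + ex (n - 6)`.

Uniqueness of the outer graph requires the extremal path-free graphs on `m` vertices: complete for
`m ≤ 6`, `K_6` with an isolated vertex for `m = 7`, a full star for `m ≥ 8`. The last two cases rest
on `card_le_of_centerClosed`, which bounds graphs with neither path nor triangle by counting around
the common vertex of two edges that meet once. Graphs with a triangle are controlled by the first
half of the argument, applied to smaller vertex sets. -/

namespace KGraph

open Finset

/-! ### Families with neither a linear path nor a linear triangle -/

section TriangleFree

variable {V : Type*} [DecidableEq V]

/-- No three members of `H` form a linear path. -/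
def LinPathFree (H : Finset (Finset V)) : Prop :=
  ∀ e ∈ H, ∀ f ∈ H, ∀ g ∈ H, #(e ∩ f) = 1 → #(f ∩ g) = 1 → #(e ∩ g) ≠ 0

/-- No three members of `H` form a linear triangle. -/
def LinTriangleFree (H : Finset (Finset V)) : Prop :=
  ∀ e ∈ H, ∀ f ∈ H, ∀ g ∈ H, #(e ∩ f) = 1 → #(f ∩ g) = 1 → #(e ∩ g) = 1 → #(e ∩ f ∩ g) ≠ 0

theorem triple_distinct {x a b : V} (h : #({x, a, b} : Finset V) = 3) :
    x ≠ a ∧ x ≠ b ∧ a ≠ b := by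
  have h2 : ∀ y z : V, #({y, z} : Finset V) ≤ 2 := fun _ _ => card_le_two
  refine ⟨?_, ?_, ?_⟩ <;> rintro rfl
  · have := h2 x b; simp at h; omega
  · have := h2 a x; rw [insert_comm] at h; simp at h; omega
  · have := h2 x a; simp at h; omega

/-- The condition that paths and triangles impose on an edge `g` avoiding the common vertex `x` of
two edges that meet only in `x`. -/
def CenterClosed (H : Finset (Finset V)) : Prop :=
  ∀ x a b c d : V, ∀ g ∈ H, {x, a, b} ∈ H → {x, c, d} ∈ H → a ≠ c → a ≠ d → b ≠ c → b ≠ d →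
    x ∉ g → a ∈ g → b ∈ g ∨ (c ∈ g ∧ d ∈ g)

/-- If the conclusion fails, `g` meets `{x, a, b}` only in `a` and meets `{x, c, d}` in at most one
vertex. No intersection gives a path with `{x, a, b}` in the middle; one common vertex gives a
triangle. -/
theorem centerClosed_of_free {H : Finset (Finset V)} (h3 : ∀ e ∈ H, #e = 3)
    (hP : LinPathFree H) (hT : LinTriangleFree H) : CenterClosed H := by
  intro x a b c d g hg hab hcd hac had hbc hbd hx ha
  obtain ⟨hxa, hxb, hab'⟩ := triple_distinct (h3 _ hab)
  obtain ⟨hxc, hxd, hcd'⟩ := triple_distinct (h3 _ hcd)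
  by_contra! hcon
  obtain ⟨hb, hcd2⟩ := hcon
  have h1 : g ∩ {x, a, b} = {a} := by ext z; simp; grind
  have h2 : ({x, a, b} : Finset V) ∩ {x, c, d} = {x} := by ext z; simp; grind
  have h4 : g ∩ {x, a, b} ∩ {x, c, d} = ∅ := by rw [h1]; ext z; simp; grind
  have h5 : #(g ∩ {x, c, d}) = 0 ∨ #(g ∩ {x, c, d}) = 1 := by
    by_cases hc : c ∈ g
    · right; rw [card_eq_one]; exact ⟨c, by ext z; simp; grind⟩
    · by_cases hd : d ∈ g
      · right; rw [card_eq_one]; exact ⟨d, by ext z; simp; grind⟩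
      · left; rw [card_eq_zero]; ext z; simp; grind
  rcases h5 with h5 | h5
  · exact hP g hg _ hab _ hcd (by rw [h1]; simp) (by rw [h2]; simp) h5
  · exact hT g hg _ hab _ hcd (by rw [h1]; simp) (by rw [h2]; simp) h5 (by rw [h4]; simp)

theorem CenterClosed.mono {H H' : Finset (Finset V)} (h : CenterClosed H) (hs : H' ⊆ H) :
    CenterClosed H' :=
  fun x a b c d g hg hab hcd => h x a b c d g (hs hg) (hs hab) (hs hcd)

/-- When both kinds of edge occur, compatibility forces all the free vertices `r` and `q` to
coincide, which leaves three edges. Otherwise only one kind occurs and it is counted by its free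
vertex. -/
theorem card_two_spoke_family {G : Finset (Finset V)} {x a b : V} {R Q : Finset V}
    (hG : ∀ e ∈ G, (∃ r ∈ R, e = {a, b, r}) ∨ ∃ q ∈ Q, e = {x, a, q} ∨ e = {x, b, q})
    (hc : ∀ r ∈ R, ∀ q ∈ Q, {a, b, r} ∈ G → {x, a, q} ∈ G ∨ {x, b, q} ∈ G → r = q) :
    #G ≤ #R ∨ (#G ≤ 2 * #Q ∧ ∀ r ∈ R, {a, b, r} ∉ G) ∨ #G ≤ 3 := by
  by_cases hN : ∃ q ∈ Q, {x, a, q} ∈ G ∨ {x, b, q} ∈ G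
  · obtain ⟨q0, hq0, hN⟩ := hN
    right
    by_cases hA : ∃ r ∈ R, {a, b, r} ∈ G
    · obtain ⟨r, hr, hA⟩ := hA
      right
      have hs : G ⊆ {{a, b, r}, {x, a, r}, {x, b, r}} := by
        intro e he
        rcases hG e he with ⟨r', hr', rfl⟩ | ⟨q, hq, h⟩
        · have h1 := hc r' hr' q0 hq0 he hN
          have h2 := hc r hr q0 hq0 hA hN
          simp [h1, h2]
        · have : r = q := hc r hr q hq hA (by rcases h with rfl | rfl <;> simp [he])
          rcases h with rfl | rfl <;> simp [this]
      exact (card_le_card hs).trans card_le_three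
    · left
      push Not at hA
      refine ⟨?_, hA⟩
      have hs : G ⊆ Q.image (fun q => {x, a, q}) ∪ Q.image (fun q => {x, b, q}) := by
        intro e he
        rcases hG e he with ⟨r', hr', rfl⟩ | ⟨q, hq, rfl | rfl⟩
        · exact absurd he (hA r' hr')
        · exact mem_union_left _ (mem_image_of_mem _ hq)
        · exact mem_union_right _ (mem_image_of_mem (fun q => ({x, b, q} : Finset V)) hq)
      have h1 := card_le_card hs
      have h2 := card_union_le (Q.image (fun q => ({x, a, q} : Finset V)))
        (Q.image (fun q => {x, b, q}))
      have h3 := card_image_le (s := Q) (f := fun q => ({x, a, q} : Finset V))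
      have h4 := card_image_le (s := Q) (f := fun q => ({x, b, q} : Finset V))
      omega
  · left
    push Not at hN
    have hs : G ⊆ R.image (fun r => {a, b, r}) := by
      intro e he
      rcases hG e he with ⟨r, hr, rfl⟩ | ⟨q, hq, rfl | rfl⟩
      · exact mem_image_of_mem _ hr
      · exact absurd he (hN q hq).1
      · exact absurd he (hN q hq).2
    exact (card_le_card hs).trans card_image_le

theorem triple_with_vertex {e : Finset V} (he : #e = 3) {x : V} (hx : x ∈ e) :
    ∃ u v, e = {x, u, v} ∧ x ≠ u ∧ x ≠ v ∧ u ≠ v := by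
  have h2 : #(e.erase x) = 2 := by rw [card_erase_of_mem hx, he]
  obtain ⟨u, v, huv, h⟩ := card_eq_two.1 h2
  have : e = {x, u, v} := by rw [← insert_erase hx, h]
  exact ⟨u, v, this, triple_distinct (this ▸ he)⟩

theorem triple_with_pair {e : Finset V} (he : #e = 3) {a b : V} (hab : a ≠ b) (ha : a ∈ e)
    (hb : b ∈ e) : ∃ r, e = {a, b, r} ∧ a ≠ r ∧ b ≠ r := by
  obtain ⟨u, v, rfl, h1, h2, h3⟩ := triple_with_vertex he ha
  have : b = u ∨ b = v := by simpa [hab.symm] using hb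
  rcases this with rfl | rfl
  · exact ⟨v, rfl, h2, h3⟩
  · exact ⟨u, by ext; simp; tauto, h1, h3.symm⟩

theorem choose_two_add_two (k : ℕ) : (k + 2).choose 2 = k.choose 2 + 2 * k + 1 := by
  simp [Nat.choose_succ_succ']; omega

theorem choose_two_add_four (k : ℕ) : (k + 4).choose 2 = k.choose 2 + 4 * k + 6 := by
  rw [choose_two_add_two (k + 2), choose_two_add_two k]; omega

set_option maxHeartbeats 600000 in
/-- The edges through `x` inside `insert x O` together with those inside `O` number at most
`C(|O|, 2) + 1`. -/
theorem card_le_of_link_compatible (x : V) {F : Finset (Finset V)} (h3 : ∀ e ∈ F, #e = 3)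
    (hc : ∀ u v, {x, u, v} ∈ F → ∀ g ∈ F, x ∉ g → u ∈ g → v ∈ g)
    (hS : ∀ S : Finset V, #(F.filter (· ⊆ S)) ≤ (#S).choose 2) :
    ∀ k : ℕ, ∀ O : Finset V, #O = k → x ∉ O → #(F.filter (· ⊆ insert x O)) ≤ k.choose 2 + 1 := by
  intro k
  induction k using Nat.strong_induction_on with
  | _ k ih =>
  intro O hO hxO
  -- Here all triples are allowed; `k = 3` attains the bound, as four triples on four vertices equal
  -- `3 + 1`. This is the source of the additive 1.
  by_cases hk : k ≤ 3
  · have h1 : F.filter (· ⊆ insert x O) ⊆ powersetCard 3 (insert x O) := by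
      intro e he
      rw [mem_filter] at he
      exact mem_powersetCard.2 ⟨he.2, h3 e he.1⟩
    have h2 := card_le_card h1
    rw [card_powersetCard, card_insert_of_notMem hxO, hO] at h2
    refine h2.trans ?_
    interval_cases k <;> decide
  push Not at hk
  by_cases hL : ∃ e ∈ F, e ⊆ insert x O ∧ x ∈ e
  · obtain ⟨e, heF, heO, hxe⟩ := hL
    obtain ⟨q, q', rfl, hxq, hxq', hqq'⟩ := triple_with_vertex (h3 e heF) hxe
    have hqO : q ∈ O := by have := heO (show q ∈ _ by simp); simpa [hxq.symm] using this
    have hq'O : q' ∈ O := by have := heO (show q' ∈ _ by simp); simpa [hxq'.symm] using this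
    set O' := (O.erase q).erase q' with hO'
    have hcard : #O' = k - 2 := by
      rw [hO', card_erase_of_mem (by simp [hqq'.symm, hq'O]), card_erase_of_mem hqO, hO]; omega
    have hI := ih (k - 2) (by omega) O' hcard (by simp [hO', hxO])
    have heF' : {x, q', q} ∈ F := by rwa [show ({x, q', q} : Finset V) = {x, q, q'} by ext; simp; tauto]
    set G := F.filter (fun e => (∃ r ∈ O', e = {q, q', r}) ∨
      ∃ r ∈ O', e = {x, q, r} ∨ e = {x, q', r}) with hGdef
    have hG := card_two_spoke_family (G := G) (x := x) (a := q) (b := q') (R := O') (Q := O')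
      (fun e he => (mem_filter.1 he).2) (by
        intro r hr s hs h1 h2
        have h1 := (mem_filter.1 h1).1
        have hr' : x ∉ ({q, q', r} : Finset V) := by
          simp only [hO', mem_erase] at hr
          simp; refine ⟨hxq, hxq', ?_⟩; rintro rfl; tauto
        have hs1 : s ≠ q ∧ s ≠ q' := by simp only [hO', mem_erase] at hs; tauto
        rcases h2 with h2 | h2
        · have := hc q s (mem_filter.1 h2).1 _ h1 hr' (by simp)
          simp at this; tauto
        · have := hc q' s (mem_filter.1 h2).1 _ h1 hr' (by simp)
          simp at this; tauto)
    -- Deleting `q` and `q'` loses the edge `{x, q, q'}` and at most `2 * (k - 2)` others, exactly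
    -- the difference between `k.choose 2` and `(k - 2).choose 2`.
    have hcov : F.filter (· ⊆ insert x O) ⊆
        {({x, q, q'} : Finset V)} ∪ G ∪ F.filter (· ⊆ insert x O') := by
      intro e he
      obtain ⟨he, hes⟩ := mem_filter.1 he
      by_cases hq : q ∈ e ∨ q' ∈ e
      · by_cases hx : x ∈ e
        · simp only [mem_union, mem_singleton, hGdef, mem_filter]
          left
          have hO'' : ∀ r ∈ e, x ≠ r → q ≠ r → q' ≠ r → r ∈ O' := fun r hr h h' h'' => by
            have := hes hr
            simp only [mem_insert, hO', mem_erase] at this ⊢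
            exact ⟨h''.symm, h'.symm, this.resolve_left h.symm⟩
          rcases hq with h | h
          · obtain ⟨r, rfl, hxr, hqr⟩ := triple_with_pair (h3 e he) hxq hx h
            by_cases hr : q' = r
            · exact Or.inl (by rw [hr])
            · exact Or.inr ⟨he, Or.inr ⟨r, hO'' r (by simp) hxr hqr hr, Or.inl rfl⟩⟩
          · obtain ⟨r, rfl, hxr, hqr⟩ := triple_with_pair (h3 e he) hxq' hx h
            by_cases hr : q = r
            · exact Or.inl (by rw [hr]; ext; simp; tauto)
            · exact Or.inr ⟨he, Or.inr ⟨r, hO'' r (by simp) hxr hr hqr, Or.inr rfl⟩⟩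
        · have h1 : q ∈ e ∧ q' ∈ e := by
            rcases hq with h | h
            · exact ⟨h, hc q q' heF e he hx h⟩
            · exact ⟨hc q' q heF' e he hx h, h⟩
          obtain ⟨r, rfl, hr, hr'⟩ := triple_with_pair (h3 e he) hqq' h1.1 h1.2
          have hrx : r ≠ x := by rintro rfl; simp at hx
          have hrO : r ∈ O := by have := hes (show r ∈ _ by simp); simpa [hrx] using this
          refine mem_union_left _ (mem_union_right _ (mem_filter.2 ⟨he, Or.inl ⟨r, ?_, rfl⟩⟩))
          simp [hO', hr.symm, hr'.symm, hrO]
      · push Not at hq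
        refine mem_union_right _ (mem_filter.2 ⟨he, fun z hz => ?_⟩)
        have hz' := hes hz
        simp only [mem_insert, hO', mem_erase] at hz' ⊢
        rcases hz' with h | h
        · exact Or.inl h
        · exact Or.inr ⟨fun h' => hq.2 (h' ▸ hz), fun h' => hq.1 (h' ▸ hz), h⟩
    have h1 := card_le_card hcov
    have h2 := card_union_le ({({x, q, q'} : Finset V)} ∪ G) (F.filter (· ⊆ insert x O'))
    have h4 := card_union_le {({x, q, q'} : Finset V)} G
    rw [card_singleton] at h4
    obtain ⟨j, rfl⟩ : ∃ j, k = j + 2 := ⟨k - 2, by omega⟩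
    rw [choose_two_add_two]
    simp only [Nat.add_sub_cancel] at hI hcard
    omega
  · push Not at hL
    have : F.filter (· ⊆ insert x O) ⊆ F.filter (· ⊆ O) := by
      intro e he
      obtain ⟨he, hes⟩ := mem_filter.1 he
      refine mem_filter.2 ⟨he, (subset_insert_iff_of_notMem (hL e he hes)).1 hes⟩
    have h1 := card_le_card this
    have h2 := hS O
    rw [hO] at h2
    omega

/-- If no two edges meet in exactly one vertex, the edges are few. -/
theorem three_mul_card_le_of_no_single_inter {H : Finset (Finset V)} {W : Finset V}
    (h3 : ∀ e ∈ H, #e = 3) (hW : ∀ e ∈ H, e ⊆ W) (h5 : 5 ≤ #W)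
    (h1 : ∀ e ∈ H, ∀ f ∈ H, #(e ∩ f) ≠ 1) : 3 * #H ≤ #W * (#W - 2) := by
  -- Any two pairs in the link of `x` intersect, so the link is a star or a triangle. A triangle has
  -- 3 edges, within the bound because `5 ≤ #W`.
  have hdeg : ∀ x ∈ W, #(H.filter (x ∈ ·)) ≤ #W - 2 := by
    intro x hxW
    by_cases hne : ∃ e ∈ H, x ∈ e
    · obtain ⟨e, he, hx⟩ := hne
      obtain ⟨a, b, rfl, hxa, hxb, hab⟩ := triple_with_vertex (h3 e he) hx
      have haW : a ∈ W := hW _ he (by simp)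
      have hbW : b ∈ W := hW _ he (by simp)
      set Q := ((W.erase x).erase a).erase b with hQ
      have hQc : #Q = #W - 3 := by
        rw [hQ, card_erase_of_mem (by simp [hab.symm, hxb.symm, hbW]),
          card_erase_of_mem (by simp [hxa.symm, haW]), card_erase_of_mem hxW]; omega
      have hmem : ∀ f ∈ H, x ∈ f → f = {x, a, b} ∨ (∃ q ∈ Q, f = {x, a, q}) ∨
          ∃ q ∈ Q, f = {x, b, q} := by
        intro f hf hxf
        have hm : a ∈ f ∨ b ∈ f := by
          by_contra! hcon
          refine h1 _ he _ hf (card_eq_one.2 ⟨x, ?_⟩)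
          ext z; simp; grind
        have hQ' : ∀ r ∈ f, x ≠ r → a ≠ r → b ≠ r → r ∈ Q := fun r hr h h' h'' => by
          simp only [hQ, mem_erase]
          exact ⟨h''.symm, h'.symm, h.symm, hW f hf hr⟩
        rcases hm with h | h
        · obtain ⟨r, rfl, hxr, har⟩ := triple_with_pair (h3 f hf) hxa hxf h
          by_cases hr : b = r
          · exact Or.inl (by rw [hr])
          · exact Or.inr (Or.inl ⟨r, hQ' r (by simp) hxr har hr, rfl⟩)
        · obtain ⟨r, rfl, hxr, hbr⟩ := triple_with_pair (h3 f hf) hxb hxf h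
          by_cases hr : a = r
          · exact Or.inl (by rw [hr]; ext; simp; tauto)
          · exact Or.inr (Or.inr ⟨r, hQ' r (by simp) hxr hr hbr, rfl⟩)
      have himg : ∀ c, #(insert {x, a, b} (Q.image fun q => ({x, c, q} : Finset V))) ≤ #W - 2 := by
        intro c
        refine (card_insert_le _ _).trans ?_
        have := card_image_le (s := Q) (f := fun q => ({x, c, q} : Finset V))
        omega
      by_cases hA : ∃ p ∈ Q, {x, a, p} ∈ H
      · obtain ⟨p, hp, hpH⟩ := hA
        by_cases hB : ∃ q ∈ Q, {x, b, q} ∈ H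
        · obtain ⟨q, hq, hqH⟩ := hB
          have hall : ∀ p ∈ Q, ∀ q ∈ Q, {x, a, p} ∈ H → {x, b, q} ∈ H → p = q := by
            intro p hp q hq h h'
            by_contra hpq
            refine h1 _ h _ h' (card_eq_one.2 ⟨x, ?_⟩)
            simp only [hQ, mem_erase] at hp hq
            ext z; simp; grind
          have hs : H.filter (x ∈ ·) ⊆ {{x, a, b}, {x, a, p}, {x, b, p}} := by
            intro f hf
            obtain ⟨hf, hxf⟩ := mem_filter.1 hf
            rcases hmem f hf hxf with rfl | ⟨r, hr, rfl⟩ | ⟨r, hr, rfl⟩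
            · simp
            · have e1 := hall r hr q hq hf hqH
              have e2 := hall p hp q hq hpH hqH
              simp [e1, e2]
            · have e2 := hall p hp r hr hpH hf
              simp [e2]
          refine (card_le_card hs).trans (card_le_three.trans (by omega))
        · refine (card_le_card ?_).trans (himg a)
          intro f hf
          obtain ⟨hf, hxf⟩ := mem_filter.1 hf
          rcases hmem f hf hxf with rfl | ⟨r, hr, rfl⟩ | ⟨r, hr, rfl⟩
          · simp
          · exact mem_insert_of_mem (mem_image_of_mem (fun q => ({x, a, q} : Finset V)) hr)
          · exact absurd ⟨r, hr, hf⟩ hB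
      · refine (card_le_card ?_).trans (himg b)
        intro f hf
        obtain ⟨hf, hxf⟩ := mem_filter.1 hf
        rcases hmem f hf hxf with rfl | ⟨r, hr, rfl⟩ | ⟨r, hr, rfl⟩
        · simp
        · exact absurd ⟨r, hr, hf⟩ hA
        · exact mem_insert_of_mem (mem_image_of_mem (fun q => ({x, b, q} : Finset V)) hr)
    · push Not at hne
      rw [filter_false_of_mem (fun e he => hne e he)]; simp
  have := card_mul_le_card_mul (s := H) (t := W) (fun e v => v ∈ e) (m := 3) (n := #W - 2)
    (fun e he => by
      have : W.bipartiteAbove (fun e v => v ∈ e) e = e := by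
        ext v; simp only [mem_bipartiteAbove]; exact ⟨fun h => h.2, fun h => ⟨hW e he h, h⟩⟩
      rw [this, h3 e he])
    (fun x hx => hdeg x hx)
  omega

/-- The edges of `H` that contain `a, b` but not `x`, or `x`, one of `a, b`, and a vertex of `O`. -/
def sector (H : Finset (Finset V)) (x a b c d : V) (O : Finset V) : Finset (Finset V) :=
  H.filter fun e => (∃ r ∈ insert c (insert d O), e = {a, b, r}) ∨
    ∃ q ∈ O, e = {x, a, q} ∨ e = {x, b, q}

/-- `CenterClosed` supplies the compatibility needed by `card_two_spoke_family`. An edge inside `O`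
excludes one of its vertices as the end of a spoke `{x, a, q}` or `{x, b, q}`; hence the improvement
from `2 * #O` to `2 * (#O - 1)`. -/
theorem sector_card {H : Finset (Finset V)} (h3 : ∀ e ∈ H, #e = 3) (hC : CenterClosed H)
    {x a b c d : V} {O : Finset V} (hab : {x, a, b} ∈ H) (hcd : {x, c, d} ∈ H)
    (hac : a ≠ c) (had : a ≠ d) (hbc : b ≠ c) (hbd : b ≠ d)
    (hx : x ∉ O) (ha : a ∉ O) (hb : b ∉ O) (hc : c ∉ O) (hd : d ∉ O) :
    (#(sector H x a b c d O) ≤ #O + 2 ∨ (#(sector H x a b c d O) ≤ 2 * #O ∧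
        ∀ r ∈ insert c (insert d O), {a, b, r} ∉ H) ∨ #(sector H x a b c d O) ≤ 3) ∧
      ∀ g ∈ H, g ⊆ O → #(sector H x a b c d O) ≤ #O + 2 ∨
        #(sector H x a b c d O) ≤ 2 * (#O - 1) ∨ #(sector H x a b c d O) ≤ 3 := by
  obtain ⟨hxa, hxb, hab'⟩ := triple_distinct (h3 _ hab)
  obtain ⟨hxc, hxd, hcd'⟩ := triple_distinct (h3 _ hcd)
  have hR : #(insert c (insert d O)) ≤ #O + 2 :=
    (card_insert_le _ _).trans (Nat.succ_le_succ (card_insert_le _ _))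
  have hcompat : ∀ r ∈ insert c (insert d O), ∀ q ∈ O, {a, b, r} ∈ sector H x a b c d O →
      {x, a, q} ∈ sector H x a b c d O ∨ {x, b, q} ∈ sector H x a b c d O → r = q := by
    intro r hr q hq h1 h2
    have h1 := (mem_filter.1 h1).1
    have hxr : x ≠ r := by rintro rfl; simp [hxc, hxd, hx] at hr
    have hqc : q ≠ c := by rintro rfl; exact hc hq
    have hqd : q ≠ d := by rintro rfl; exact hd hq
    have hqa : q ≠ a := by rintro rfl; exact ha hq
    have hqb : q ≠ b := by rintro rfl; exact hb hq
    rcases h2 with h2 | h2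
    · have := hC x a q c d _ h1 (mem_filter.1 h2).1 hcd hac had hqc hqd
        (by simp [hxa, hxb, hxr]) (by simp)
      simp only [mem_insert, mem_singleton, hqa, hqb, hac.symm, had.symm, hbc.symm, hbd.symm,
        false_or] at this
      rcases this with h | ⟨h, h'⟩
      · exact h.symm
      · exact absurd (h.trans h'.symm) hcd'
    · have := hC x b q c d _ h1 (mem_filter.1 h2).1 hcd hbc hbd hqc hqd
        (by simp [hxa, hxb, hxr]) (by simp)
      simp only [mem_insert, mem_singleton, hqa, hqb, hac.symm, had.symm, hbc.symm, hbd.symm,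
        false_or] at this
      rcases this with h | ⟨h, h'⟩
      · exact h.symm
      · exact absurd (h.trans h'.symm) hcd'
  constructor
  · rcases card_two_spoke_family (G := sector H x a b c d O) (x := x) (a := a) (b := b)
      (R := insert c (insert d O)) (Q := O) (fun e he => (mem_filter.1 he).2) hcompat with
      h | ⟨h, h'⟩ | h
    · exact Or.inl (h.trans hR)
    · exact Or.inr (Or.inl ⟨h, fun r hr hH =>
        h' r hr (mem_filter.2 ⟨hH, Or.inl ⟨r, hr, rfl⟩⟩)⟩)
    · exact Or.inr (Or.inr h)
  · intro g hg hgO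
    obtain ⟨p, hp⟩ : g.Nonempty := card_pos.1 (by rw [h3 g hg]; omega)
    have hpO := hgO hp
    have hpc : p ≠ c := by rintro rfl; exact hc hpO
    have hpd : p ≠ d := by rintro rfl; exact hd hpO
    have hno : ∀ u, u ∉ O → u ≠ c → u ≠ d → {x, u, p} ∉ H := by
      intro u hu huc hud h
      have h' : ({x, p, u} : Finset V) ∈ H := by
        rwa [show ({x, p, u} : Finset V) = {x, u, p} by ext; simp; tauto]
      rcases hC x p u c d g hg h' hcd hpc hpd huc hud (fun h => hx (hgO h)) hp with h | h
      · exact hu (hgO h)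
      · exact hc (hgO h.1)
    rcases card_two_spoke_family (G := sector H x a b c d O) (x := x) (a := a) (b := b)
      (R := insert c (insert d O)) (Q := O.erase p) (fun e he => by
        obtain ⟨heH, he⟩ := mem_filter.1 he
        rcases he with h | ⟨q, hq, h⟩
        · exact Or.inl h
        · refine Or.inr ⟨q, mem_erase.2 ⟨?_, hq⟩, h⟩
          rintro rfl
          rcases h with rfl | rfl
          · exact hno a ha hac had heH
          · exact hno b hb hbc hbd heH)
      (fun r hr q hq => hcompat r hr q (mem_of_mem_erase hq)) with
      h | ⟨h, h'⟩ | h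
    · exact Or.inl (h.trans hR)
    · rw [card_erase_of_mem hpO] at h
      exact Or.inr (Or.inl h)
    · exact Or.inr (Or.inr h)

/-- An edge avoiding `x` but meeting `{a, b, c, d}` must contain `a, b` or `c, d`, by
`CenterClosed`. Edges through `x` are sorted by how many of these four vertices they contain. -/
theorem center_cover {H : Finset (Finset V)} {W : Finset V} (h3 : ∀ e ∈ H, #e = 3)
    (hW : ∀ e ∈ H, e ⊆ W) (hC : CenterClosed H) {x a b c d : V} (hab : {x, a, b} ∈ H)
    (hcd : {x, c, d} ∈ H) (hac : a ≠ c) (had : a ≠ d) (hbc : b ≠ c) (hbd : b ≠ d) :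
    let O := W \ {x, a, b, c, d}
    ∀ e ∈ H, e ∈ (powersetCard 2 ({a, b, c, d} : Finset V)).image (insert x) ∨
      e ∈ sector H x a b c d O ∨ e ∈ sector H x c d a b O ∨ e ∈ H.filter (· ⊆ insert x O) := by
  intro O e he
  obtain ⟨hxa, hxb, hab'⟩ := triple_distinct (h3 _ hab)
  obtain ⟨hxc, hxd, hcd'⟩ := triple_distinct (h3 _ hcd)
  have hO : ∀ z ∈ e, z ≠ x → z ≠ a → z ≠ b → z ≠ c → z ≠ d → z ∈ O := by
    intro z hz h1 h2 h4 h5 h6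
    simp only [O, mem_sdiff, mem_insert, mem_singleton]
    exact ⟨hW e he hz, by tauto⟩
  have hba : ({x, b, a} : Finset V) ∈ H := by
    rwa [show ({x, b, a} : Finset V) = {x, a, b} by ext; simp; tauto]
  have hdc : ({x, d, c} : Finset V) ∈ H := by
    rwa [show ({x, d, c} : Finset V) = {x, c, d} by ext; simp; tauto]
  by_cases hx : x ∈ e
  · by_cases hm : ∃ u ∈ ({a, b, c, d} : Finset V), u ∈ e
    · obtain ⟨u, hu, hue⟩ := hm
      have hxu : x ≠ u := by rintro rfl; simp [hxa, hxb, hxc, hxd] at hu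
      obtain ⟨v, rfl, hxv, huv⟩ := triple_with_pair (h3 e he) hxu hx hue
      by_cases hv : v ∈ ({a, b, c, d} : Finset V)
      · left
        refine mem_image.2 ⟨{u, v}, mem_powersetCard.2 ⟨?_, card_pair huv⟩, rfl⟩
        intro z hz
        rcases mem_insert.1 hz with rfl | hz
        · exact hu
        · rw [mem_singleton.1 hz]; exact hv
      · right
        simp only [mem_insert, mem_singleton, not_or] at hu hv
        have hvO := hO v (by simp) hxv.symm hv.1 hv.2.1 hv.2.2.1 hv.2.2.2
        rcases hu with rfl | rfl | rfl | rfl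
        · exact Or.inl (mem_filter.2 ⟨he, Or.inr ⟨v, hvO, Or.inl rfl⟩⟩)
        · exact Or.inl (mem_filter.2 ⟨he, Or.inr ⟨v, hvO, Or.inr rfl⟩⟩)
        · exact Or.inr (Or.inl (mem_filter.2 ⟨he, Or.inr ⟨v, hvO, Or.inl rfl⟩⟩))
        · exact Or.inr (Or.inl (mem_filter.2 ⟨he, Or.inr ⟨v, hvO, Or.inr rfl⟩⟩))
    · push Not at hm
      refine Or.inr (Or.inr (Or.inr (mem_filter.2 ⟨he, fun z hz => ?_⟩)))
      by_cases hzx : z = x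
      · simp [hzx]
      · refine mem_insert_of_mem (hO z hz hzx ?_ ?_ ?_ ?_) <;> rintro rfl <;>
          exact hm z (by simp) hz
  · have hpair : ∀ u v w s, u ≠ v → u ∈ e → v ∈ e →
        (∀ z ∈ e, z ≠ x → z ≠ u → z ≠ v → z ≠ w → z ≠ s → z ∈ O) → e ∈ sector H x u v w s O := by
      intro u v w s huv hu hv hO'
      obtain ⟨r, rfl, hur, hvr⟩ := triple_with_pair (h3 e he) huv hu hv
      refine mem_filter.2 ⟨he, Or.inl ⟨r, ?_, rfl⟩⟩
      by_cases h1 : r = w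
      · simp [h1]
      by_cases h2 : r = s
      · simp [h2]
      have hrx : r ≠ x := by rintro rfl; simp at hx
      exact mem_insert_of_mem (mem_insert_of_mem
        (hO' r (by simp) hrx hur.symm hvr.symm h1 h2))
    have h1 : a ∈ e → b ∈ e → e ∈ sector H x a b c d O := fun ha hb =>
      hpair a b c d hab' ha hb hO
    have h2 : c ∈ e → d ∈ e → e ∈ sector H x c d a b O := fun hc hd =>
      hpair c d a b hcd' hc hd (fun z hz h1 h2 h3 h4 h5 => hO z hz h1 h4 h5 h2 h3)
    by_cases ha : a ∈ e
    · rcases hC x a b c d e he hab hcd hac had hbc hbd hx ha with h | h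
      · exact Or.inr (Or.inl (h1 ha h))
      · exact Or.inr (Or.inr (Or.inl (h2 h.1 h.2)))
    by_cases hb : b ∈ e
    · rcases hC x b a c d e he hba hcd hbc hbd hac had hx hb with h | h
      · exact absurd h ha
      · exact Or.inr (Or.inr (Or.inl (h2 h.1 h.2)))
    by_cases hc : c ∈ e
    · rcases hC x c d a b e he hcd hab hac.symm hbc.symm had.symm hbd.symm hx hc with h | h
      · exact Or.inr (Or.inr (Or.inl (h2 hc h)))
      · exact absurd h.1 ha
    by_cases hd : d ∈ e
    · rcases hC x d c a b e he hdc hab had.symm hbd.symm hac.symm hbc.symm hx hd with h | h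
      · exact absurd h hc
      · exact absurd h.1 ha
    refine Or.inr (Or.inr (Or.inr (mem_filter.2 ⟨he, fun z hz => ?_⟩)))
    refine mem_insert_of_mem (hO z hz ?_ ?_ ?_ ?_ ?_) <;> rintro rfl <;> contradiction

theorem two_mul_choose_two (k : ℕ) : 2 * (k + 1).choose 2 = (k + 1) * k := by
  induction k with
  | zero => rfl
  | succ k ih => rw [Nat.choose_succ_succ' (k + 1) 1, mul_add, ih, Nat.choose_one_right]; ring

set_option maxHeartbeats 1000000 in
/-- The Turán bound for families with no linear path and no linear triangle, with the extremal
families identified as stars. -/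
theorem card_le_of_centerClosed : ∀ (m : ℕ) (W : Finset V) (H : Finset (Finset V)), #W = m →
    (∀ e ∈ H, #e = 3) → (∀ e ∈ H, e ⊆ W) → CenterClosed H →
    #H ≤ m.choose 2 ∧ (7 ≤ m → #H ≤ (m - 1).choose 2 ∧
      (8 ≤ m → #H = (m - 1).choose 2 → ∃ x ∈ W, ∀ e ∈ H, x ∈ e)) := by
  intro m
  induction m using Nat.strong_induction_on with
  | _ m ih =>
  intro W H hWm h3 hW hC
  by_cases hm : m ≤ 5
  · refine ⟨?_, fun h => by omega⟩
    have h1 : H ⊆ powersetCard 3 W := fun e he => mem_powersetCard.2 ⟨hW e he, h3 e he⟩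
    have h2 := card_le_card h1
    rw [card_powersetCard, hWm] at h2
    refine h2.trans ?_
    interval_cases m <;> decide
  push Not at hm
  by_cases h1 : ∃ e ∈ H, ∃ f ∈ H, #(e ∩ f) = 1
  · obtain ⟨e, he, f, hf, hef⟩ := h1
    obtain ⟨x, hx⟩ := card_eq_one.1 hef
    have hxe : x ∈ e ∩ f := by simp [hx]
    obtain ⟨a, b, rfl, hxa, hxb, hab'⟩ := triple_with_vertex (h3 e he) (mem_inter.1 hxe).1
    obtain ⟨c, d, rfl, hxc, hxd, hcd'⟩ := triple_with_vertex (h3 f hf) (mem_inter.1 hxe).2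
    have hne : ∀ u ∈ ({x, a, b} : Finset V), u ∈ ({x, c, d} : Finset V) → u = x := by
      intro u hu hv
      have : u ∈ ({x, a, b} : Finset V) ∩ {x, c, d} := mem_inter.2 ⟨hu, hv⟩
      simpa [hx] using this
    have hac : a ≠ c := by rintro rfl; exact hxa (hne a (by simp) (by simp)).symm
    have had : a ≠ d := by rintro rfl; exact hxa (hne a (by simp) (by simp)).symm
    have hbc : b ≠ c := by rintro rfl; exact hxb (hne b (by simp) (by simp)).symm
    have hbd : b ≠ d := by rintro rfl; exact hxb (hne b (by simp) (by simp)).symm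
    have hcov := center_cover h3 hW hC he hf hac had hbc hbd
    set O := W \ {x, a, b, c, d} with hOdef
    dsimp only at hcov
    have hsub : ({x, a, b, c, d} : Finset V) ⊆ W := by
      have h1 := hW _ he
      have h2 := hW _ hf
      intro z hz
      simp only [mem_insert, mem_singleton] at hz
      rcases hz with rfl | rfl | rfl | rfl | rfl
      · exact h1 (by simp)
      · exact h1 (by simp)
      · exact h1 (by simp)
      · exact h2 (by simp)
      · exact h2 (by simp)
    have h5 : #({x, a, b, c, d} : Finset V) = 5 := by
      simp [*]
    obtain ⟨k, hk⟩ : ∃ k, #O = k := ⟨_, rfl⟩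
    have hmk : m = k + 5 := by
      have : #O + _ = #W := card_sdiff_add_card_eq_card hsub
      omega
    have hxO : x ∉ O := by simp [hOdef]
    have haO : a ∉ O := by simp [hOdef]
    have hbO : b ∉ O := by simp [hOdef]
    have hcO : c ∉ O := by simp [hOdef]
    have hdO : d ∉ O := by simp [hOdef]
    have hs1 := sector_card h3 hC he hf hac had hbc hbd hxO haO hbO hcO hdO
    have hs2 := sector_card h3 hC hf he hac.symm hbc.symm had.symm hbd.symm hxO hcO hdO haO hbO
    have hcardH : #H ≤ 6 + #(sector H x a b c d O) + #(sector H x c d a b O) +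
        #(H.filter (· ⊆ insert x O)) := by
      have hsubs : H ⊆ (((powersetCard 2 ({a, b, c, d} : Finset V)).image (insert x) ∪
          sector H x a b c d O) ∪ sector H x c d a b O) ∪ H.filter (· ⊆ insert x O) := by
        intro e he
        have := hcov e he
        simp only [mem_union]
        tauto
      have h6 : #((powersetCard 2 ({a, b, c, d} : Finset V)).image (insert x)) ≤ 6 := by
        refine card_image_le.trans ?_
        rw [card_powersetCard]
        calc (#({a, b, c, d} : Finset V)).choose 2 ≤ Nat.choose 4 2 :=
              Nat.choose_le_choose 2 card_le_four
          _ = 6 := by decide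
      refine (card_le_card hsubs).trans ((card_union_le _ _).trans ?_)
      refine Nat.add_le_add_right ((card_union_le _ _).trans ?_) _
      refine Nat.add_le_add_right ((card_union_le _ _).trans ?_) _
      exact Nat.add_le_add_right h6 _
    have hbin := choose_two_add_four k
    have hbin' : (k + 5).choose 2 = (k + 4).choose 2 + (k + 4) := by
      simp [Nat.choose_succ_succ' (k + 4) 1]; omega
    have hm1 : m - 1 = k + 4 := by omega
    -- The target `(k + 4).choose 2 = 6 + 2 * k + 2 * k + k.choose 2` matches the four parts of the
    -- cover term by term.
    rw [hm1, hmk, hbin', hbin]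
    rw [hk] at hs1 hs2
    -- An edge inside `O` costs at most one extra edge in the inner part but shrinks the spoke
    -- bounds of both sectors, so the total falls strictly below the star.
    by_cases hT : ∃ g ∈ H, g ⊆ O
    · obtain ⟨g, hg, hgO⟩ := hT
      have hk3 : 3 ≤ k := by rw [← hk, ← h3 g hg]; exact card_le_card hgO
      have hI : #(H.filter (· ⊆ insert x O)) ≤ k.choose 2 + 1 := by
        have := card_le_of_link_compatible x (F := H.filter (· ⊆ insert x O))
          (fun e he => h3 e (mem_filter.1 he).1) (by
            intro u v huv g hg hxg hu
            obtain ⟨huvH, huvO⟩ := mem_filter.1 huv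
            obtain ⟨hgH, hgO⟩ := mem_filter.1 hg
            obtain ⟨hxu, hxv, -⟩ := triple_distinct (h3 _ huvH)
            have hu' : u ∈ O := (mem_insert.1 (huvO (by simp))).resolve_left hxu.symm
            have hv' : v ∈ O := (mem_insert.1 (huvO (by simp))).resolve_left hxv.symm
            have hna : a ∉ g := fun h =>
              haO ((mem_insert.1 (hgO h)).resolve_left hxa.symm)
            rcases hC x u v a b g hgH huvH he (fun h => haO (h ▸ hu')) (fun h => hbO (h ▸ hu'))
              (fun h => haO (h ▸ hv')) (fun h => hbO (h ▸ hv')) hxg hu with h | h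
            · exact h
            · exact absurd h.1 hna)
          (by
            -- A set `S` with at least `m` vertices is outside the induction, but every edge counted
            -- lies in `insert x O`, which has fewer than `m`.
            intro S
            by_cases hS : #S < m
            · exact (ih (#S) hS S _ rfl
                (fun e he => h3 e (mem_filter.1 (mem_filter.1 he).1).1)
                (fun e he => (mem_filter.1 he).2)
                (hC.mono ((filter_subset _ _).trans (filter_subset _ _)))).1
            · have hsub2 : (H.filter (· ⊆ insert x O)).filter (· ⊆ S) ⊆
                  H.filter (· ⊆ insert x O) := filter_subset _ _
              have h1 := ih (#(insert x O)) (by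
                  have := card_insert_le x O; omega) (insert x O) (H.filter (· ⊆ insert x O)) rfl
                (fun e he => h3 e (mem_filter.1 he).1)
                (fun e he => (mem_filter.1 he).2) (hC.mono (filter_subset _ _))
              refine (card_le_card hsub2).trans (h1.1.trans (Nat.choose_le_choose 2 ?_))
              have := card_insert_le x O
              omega) k O hk hxO
        rwa [filter_filter, filter_congr (q := fun e => e ⊆ insert x O) (by simp)] at this
      have h7 := hs1.2 g hg hgO
      have h8 := hs2.2 g hg hgO
      have : #H < k.choose 2 + 4 * k + 6 := by omega
      exact ⟨by omega, fun _ => ⟨by omega, fun _ h => by omega⟩⟩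
    · push Not at hT
      have hI : #(H.filter (· ⊆ insert x O)) ≤ k.choose 2 := by
        rw [← hk, ← card_powersetCard]
        refine (card_le_card (t := (powersetCard 2 O).image (insert x)) ?_).trans card_image_le
        intro e he
        obtain ⟨heH, heO⟩ := mem_filter.1 he
        have hxe : x ∈ e := by
          by_contra hxe
          exact hT e heH ((subset_insert_iff_of_notMem hxe).1 heO)
        refine mem_image.2 ⟨e.erase x, mem_powersetCard.2 ⟨?_, ?_⟩, insert_erase hxe⟩
        · intro z hz
          obtain ⟨h1, h2⟩ := mem_erase.1 hz
          exact (mem_insert.1 (heO h2)).resolve_left h1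
        · rw [card_erase_of_mem hxe, h3 e heH]
      refine ⟨?_, fun _ => ⟨?_, fun _ heq => ⟨x, hsub (by simp), ?_⟩⟩⟩
      · rcases hs1.1 with h | ⟨h, -⟩ | h <;> rcases hs2.1 with h' | ⟨h', -⟩ | h' <;>
        · by_cases hk1 : k = 1
          · have hz : k.choose 2 = 0 := by rw [hk1]; rfl
            omega
          · omega
      · rcases hs1.1 with h | ⟨h, -⟩ | h <;> rcases hs2.1 with h' | ⟨h', -⟩ | h' <;> omega
      -- As `m ≥ 8` means `k ≥ 3`, both `k + 2` and 3 are below `2 * k`. Equality therefore puts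
      -- both sectors in the spoke case, where every edge contains `x`.
      · have h7 : ∀ r ∈ insert c (insert d O), {a, b, r} ∉ H := by
          rcases hs1.1 with h | ⟨h, h7⟩ | h
          · exfalso; rcases hs2.1 with h' | ⟨h', -⟩ | h' <;> omega
          · exact h7
          · exfalso; rcases hs2.1 with h' | ⟨h', -⟩ | h' <;> omega
        have h8 : ∀ r ∈ insert a (insert b O), {c, d, r} ∉ H := by
          rcases hs2.1 with h | ⟨h, h7⟩ | h
          · exfalso; rcases hs1.1 with h' | ⟨h', -⟩ | h' <;> omega
          · exact h7
          · exfalso; rcases hs1.1 with h' | ⟨h', -⟩ | h' <;> omega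
        intro e he
        rcases hcov e he with h | h | h | h
        · obtain ⟨s, -, rfl⟩ := mem_image.1 h
          simp
        · rcases (mem_filter.1 h).2 with ⟨r, hr, rfl⟩ | ⟨q, -, rfl | rfl⟩
          · exact absurd he (h7 r hr)
          · simp
          · simp
        · rcases (mem_filter.1 h).2 with ⟨r, hr, rfl⟩ | ⟨q, -, rfl | rfl⟩
          · exact absurd he (h8 r hr)
          · simp
          · simp
        · by_contra hxe
          exact hT e he ((subset_insert_iff_of_notMem hxe).1 (mem_filter.1 h).2)
  · push Not at h1
    have h := three_mul_card_le_of_no_single_inter h3 hW (by omega) h1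
    rw [hWm] at h
    obtain ⟨k, rfl⟩ : ∃ k, m = k + 6 := ⟨m - 6, by omega⟩
    have e1 : 2 * (k + 6).choose 2 = (k + 6) * (k + 5) := two_mul_choose_two (k + 5)
    have e2 : 2 * (k + 5).choose 2 = (k + 5) * (k + 4) := two_mul_choose_two (k + 4)
    have e3 : k + 6 - 2 = k + 4 := by omega
    have e4 : k + 6 - 1 = k + 5 := by omega
    rw [e3] at h
    rw [e4]
    have : 7 ≤ k + 6 → #H < (k + 5).choose 2 := fun h7 => by nlinarith
    exact ⟨by nlinarith, fun h7 => ⟨(this h7).le, fun _ heq => absurd heq (this h7).ne⟩⟩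

end TriangleFree

/-! ### Edges crossing the boundary of a triangle -/

section Triangle

variable {V : Type*} [DecidableEq V]

/-- The pairs of vertices of the triangle that an edge leaving the triangle may contain. -/
def netPairs : Finset (Finset (Fin 6)) := {{0, 3}, {2, 4}, {2, 5}, {0, 4}, {1, 4}, {0, 2}}

-- A finite check: every other trace of size 1 or 2 starts a path that continues along two edges of
-- the triangle.
set_option maxRecDepth 100000 in
theorem mem_netPairs_or_path : ∀ p : Finset (Fin 6), #p = 1 ∨ #p = 2 → p ∈ netPairs ∨
    ∃ S ∈ triangle3.edges, ∃ R ∈ triangle3.edges, #(p ∩ S) = 1 ∧ #(S ∩ R) = 1 ∧ #(p ∩ R) = 0 := by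
  decide

theorem exists_edge_inter_netPairs :
    ∀ p ∈ netPairs, #p = 2 ∧ ∃ S ∈ triangle3.edges, #(p ∩ S) = 1 := by
  decide

/-- The triples that can occur together with their complement in a path-free family containing the
triangle and an edge leaving the triangle through the pair `p`. -/
def complementaryTriples (p : Finset (Fin 6)) : Finset (Finset (Fin 6)) :=
  (powersetCard 3 univ).filter fun S => #(p ∩ S) ≠ 1 ∧
    (#(p ∩ S) = 0 → ∀ R ∈ triangle3.edges, #(p ∩ R) = 1 → #(R ∩ S) ≠ 1) ∧
    (#(p ∩ Sᶜ) = 0 → ∀ R ∈ triangle3.edges, #(p ∩ R) = 1 → #(R ∩ Sᶜ) ≠ 1)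

set_option maxRecDepth 100000 in
theorem card_complementaryTriples : ∀ p ∈ netPairs, #(complementaryTriples p) ≤ 2 := by
  decide

-- The six pairs are matched as a corner with its opposite midpoint against the other two corners. A
-- triangle edge joins the two matched pairs, so crossing edges through them with different outer
-- ends would complete a path.
set_option maxRecDepth 100000 in
theorem netPairs_disjoint_path : ∀ pq ∈ ([({0, 3}, {2, 4}), ({2, 5}, {0, 4}), ({1, 4}, {0, 2})] :
    List (Finset (Fin 6) × Finset (Fin 6))), #(pq.1 ∩ pq.2) = 0 ∧
      ∃ S ∈ triangle3.edges, #(pq.1 ∩ S) = 1 ∧ #(S ∩ pq.2) = 1 := by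
  decide

/-- The trace of `e` on the image of `φ`. -/
def trace (φ : Fin 6 ↪ V) (e : Finset V) : Finset (Fin 6) := univ.filter (φ · ∈ e)

theorem inter_map_eq (φ : Fin 6 ↪ V) (e : Finset V) (S : Finset (Fin 6)) :
    e ∩ S.map φ = (trace φ e ∩ S).map φ := by
  ext z
  simp only [mem_inter, mem_map, trace, mem_filter, mem_univ, true_and]
  constructor
  · rintro ⟨h, i, hi, rfl⟩; exact ⟨i, ⟨h, hi⟩, rfl⟩
  · rintro ⟨i, ⟨h, hi⟩, rfl⟩; exact ⟨h, i, hi, rfl⟩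

theorem card_inter_map (φ : Fin 6 ↪ V) (e : Finset V) (S : Finset (Fin 6)) :
    #(e ∩ S.map φ) = #(trace φ e ∩ S) := by
  rw [inter_map_eq, card_map]

theorem card_map_inter (φ : Fin 6 ↪ V) (e : Finset V) (S : Finset (Fin 6)) :
    #(S.map φ ∩ e) = #(trace φ e ∩ S) := by
  rw [inter_comm, card_inter_map]

theorem card_map_inter_map {α : Type*} [DecidableEq α] (φ : α ↪ V) (S T : Finset α) :
    #(S.map φ ∩ T.map φ) = #(S ∩ T) := by
  rw [← map_inter, card_map]

theorem trace_insert_map (φ : Fin 6 ↪ V) {y : V} (hy : y ∉ univ.map φ) (p : Finset (Fin 6)) :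
    trace φ (insert y (p.map φ)) = p := by
  ext i
  have : φ i ≠ y := by rintro rfl; simp at hy
  simp [trace, this]

section

variable {H : Finset (Finset V)} (h3 : ∀ e ∈ H, #e = 3) (hP : LinPathFree H) (φ : Fin 6 ↪ V)
  (hφ : ∀ S ∈ triangle3.edges, S.map φ ∈ H)

include h3 hP hφ

theorem crossing_edge {e : Finset V} (he : e ∈ H) (h1 : ¬ e ⊆ univ.map φ)
    (h2 : ¬ Disjoint e (univ.map φ)) :
    ∃ p ∈ netPairs, ∃ y, y ∉ univ.map φ ∧ e = insert y (p.map φ) := by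
  have hcard : #(trace φ e) = #(e ∩ univ.map φ) := by rw [card_inter_map, inter_univ]
  have hpos : 0 < #(e ∩ univ.map φ) := by
    rw [card_pos, ← not_disjoint_iff_nonempty_inter]; exact h2
  have hsd : #(e ∩ univ.map φ) + #(e \ univ.map φ) = 3 := by
    rw [card_inter_add_card_sdiff, h3 e he]
  have hpos2 : 0 < #(e \ univ.map φ) := by
    rw [card_pos, sdiff_nonempty]; exact h1
  rcases mem_netPairs_or_path (trace φ e) (by omega) with h | ⟨S, hS, R, hR, h4, h5, h6⟩
  · refine ⟨trace φ e, h, ?_⟩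
    have h2 := (exists_edge_inter_netPairs _ h).1
    obtain ⟨y, hy⟩ := card_eq_one.1 (show #(e \ univ.map φ) = 1 by omega)
    refine ⟨y, ?_, ?_⟩
    · have : y ∈ e \ univ.map φ := by rw [hy]; simp
      exact (mem_sdiff.1 this).2
    · have := inter_map_eq φ e univ
      rw [inter_univ] at this
      rw [← this, insert_eq, ← hy, union_comm]
      ext z; simp only [mem_union, mem_inter, mem_sdiff]; tauto
  · exact absurd (by rw [card_inter_map]; exact h6) (hP e he _ (hφ S hS) _ (hφ R hR)
      (by rw [card_inter_map]; exact h4) (by rw [card_map_inter_map]; exact h5))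

-- An edge `g` missing the triangle but containing `y` would form the path `g`, crossing edge,
-- triangle edge.
omit h3 in
theorem crossing_disjoint {p : Finset (Fin 6)} (hp : p ∈ netPairs) {y : V} (hy : y ∉ univ.map φ)
    (hpH : insert y (p.map φ) ∈ H) {g : Finset V} (hg : g ∈ H) (hgU : Disjoint g (univ.map φ)) :
    y ∉ g := by
  intro hyg
  obtain ⟨S, hS, h1⟩ := (exists_edge_inter_netPairs p hp).2
  have hsub : ∀ S : Finset (Fin 6), g ∩ S.map φ = ∅ := fun S =>
    disjoint_iff_inter_eq_empty.1 (hgU.mono_right (map_subset_map.2 (subset_univ S)))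
  refine hP g hg _ hpH _ (hφ S hS) ?_ ?_ ?_
  · rw [inter_insert_of_mem hyg, hsub]; simp
  · rw [card_inter_map, trace_insert_map φ hy]; exact h1
  · rw [hsub]; simp

/-- The 20 triples on six vertices form 10 complementary pairs. Given the crossing edge, at most one
pair can occur in full, hence `10 + 1`. -/
theorem card_inside_le {p : Finset (Fin 6)} (hp : p ∈ netPairs) {y : V} (hy : y ∉ univ.map φ)
    (hpH : insert y (p.map φ) ∈ H) : #(H.filter (· ⊆ univ.map φ)) ≤ 11 := by
  set I : Finset (Finset (Fin 6)) := (powersetCard 3 univ).filter fun S => S.map φ ∈ H with hI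
  have hle : #(H.filter (· ⊆ univ.map φ)) ≤ #I := by
    refine (card_le_card (t := I.image (Finset.map φ)) ?_).trans card_image_le
    intro e he
    obtain ⟨heH, heU⟩ := mem_filter.1 he
    obtain ⟨S, -, rfl⟩ := subset_map_iff.1 heU
    refine mem_image_of_mem _ (mem_filter.2 ⟨mem_powersetCard.2 ⟨subset_univ _, ?_⟩, heH⟩)
    have := h3 _ heH
    rwa [card_map] at this
  have hmem : ∀ S, S ∈ I ↔ #S = 3 ∧ S.map φ ∈ H := by
    intro S; simp [hI, mem_powersetCard]
  have hc3 : ∀ S : Finset (Fin 6), #S = 3 → #Sᶜ = 3 := by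
    intro S hS; rw [card_compl, hS]; rfl
  have htr := trace_insert_map φ hy p
  have hzero : ∀ T ∈ I, #(p ∩ T) = 0 → ∀ R ∈ triangle3.edges, #(p ∩ R) = 1 → #(R ∩ T) ≠ 1 := by
    intro T hT h0 R hR h1 h2
    refine hP _ hpH _ (hφ R hR) _ ((hmem T).1 hT).2 ?_ ?_ ?_
    · rw [card_inter_map, htr]; exact h1
    · rw [card_map_inter_map]; exact h2
    · rw [card_inter_map, htr]; exact h0
  have hboth : I ∩ I.image compl ⊆ complementaryTriples p := by
    intro S hS
    obtain ⟨h1, h2⟩ := mem_inter.1 hS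
    obtain ⟨T, hT, rfl⟩ := mem_image.1 h2
    have hTc : Tᶜᶜ = T := compl_compl T
    refine mem_filter.2 ⟨mem_powersetCard.2 ⟨subset_univ _, ((hmem _).1 h1).1⟩, ?_, hzero _ h1, ?_⟩
    -- If `p` is split between `T` and its complement, the crossing edge joins these two disjoint
    -- edges into a path.
    · intro h
      have h4 : #(p ∩ T) + #(p ∩ Tᶜ) = 2 := by
        rw [← (exists_edge_inter_netPairs p hp).1, ← card_inter_add_card_sdiff p T,
          sdiff_eq_inter_compl]
      refine hP _ ((hmem _).1 hT).2 _ hpH _ ((hmem _).1 h1).2 ?_ ?_ ?_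
      · rw [card_map_inter, htr]; omega
      · rw [card_inter_map, htr]; exact h
      · rw [card_map_inter_map]; simp
    · rw [hTc]; exact hzero _ hT
  have h1 := card_le_card hboth
  have h2 := card_complementaryTriples p hp
  have h4 := card_union_add_card_inter I (I.image compl)
  have h5 : #(I.image compl) = #I := card_image_of_injective _ compl_injective
  have h6 : #(I ∪ I.image compl) ≤ 20 := by
    refine (card_le_card (t := powersetCard 3 univ) ?_).trans (by rw [card_powersetCard]; decide)
    intro S hS
    refine mem_powersetCard.2 ⟨subset_univ _, ?_⟩
    rcases mem_union.1 hS with h | h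
    · exact ((hmem _).1 h).1
    · obtain ⟨T, hT, rfl⟩ := mem_image.1 h
      exact hc3 T ((hmem _).1 hT).1
  omega

-- If both pairs are used, all outer ends coincide and at most two edges arise; if only one is used,
-- its edges are counted by their outer ends.
omit h3 in
theorem card_crossing_pair_le {p q : Finset (Fin 6)} (hpq : (p, q) ∈
      ([({0, 3}, {2, 4}), ({2, 5}, {0, 4}), ({1, 4}, {0, 2})] :
        List (Finset (Fin 6) × Finset (Fin 6)))) {Y : Finset V}
    (hY : ∀ y ∈ Y, y ∉ univ.map φ) :
    #(H.filter fun e => ∃ y ∈ Y, e = insert y (p.map φ) ∨ e = insert y (q.map φ)) ≤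
      max #Y 2 := by
  have hkey : ∀ y ∈ Y, ∀ z ∈ Y, insert y (p.map φ) ∈ H → insert z (q.map φ) ∈ H → y = z := by
    intro y hy z hz h1 h2
    by_contra hyz
    obtain ⟨h0, S, hS, h4, h5⟩ := netPairs_disjoint_path _ hpq
    refine hP _ h1 _ (hφ S hS) _ h2 ?_ ?_ ?_
    · rw [card_inter_map, trace_insert_map φ (hY y hy)]; exact h4
    · rw [card_map_inter, trace_insert_map φ (hY z hz), inter_comm]; exact h5
    · have hy' : y ∉ insert z (q.map φ) := by
        rw [mem_insert, not_or]
        exact ⟨hyz, fun h => hY y hy (map_subset_map.2 (subset_univ _) h)⟩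
      rw [insert_inter_of_notMem hy', card_map_inter, trace_insert_map φ (hY z hz), inter_comm]
      exact h0
  by_cases hA : ∃ y ∈ Y, insert y (p.map φ) ∈ H
  · obtain ⟨y, hy, hA⟩ := hA
    by_cases hB : ∃ z ∈ Y, insert z (q.map φ) ∈ H
    · obtain ⟨z, hz, hB⟩ := hB
      have hs : (H.filter fun e => ∃ y ∈ Y, e = insert y (p.map φ) ∨ e = insert y (q.map φ)) ⊆
          {insert z (p.map φ), insert y (q.map φ)} := by
        intro e he
        obtain ⟨heH, u, hu, rfl | rfl⟩ := mem_filter.1 he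
        · rw [hkey u hu z hz heH hB]; simp
        · rw [← hkey y hy u hu hA heH]; simp
      exact (card_le_card hs).trans (card_le_two.trans (le_max_right _ _))
    · refine le_trans ((card_le_card (t := Y.image fun y => insert y (p.map φ)) ?_).trans
        card_image_le) (le_max_left _ _)
      intro e he
      obtain ⟨heH, u, hu, rfl | rfl⟩ := mem_filter.1 he
      · exact mem_image_of_mem (fun y => insert y (p.map φ)) hu
      · exact absurd ⟨u, hu, heH⟩ hB
  · refine le_trans ((card_le_card (t := Y.image fun y => insert y (q.map φ)) ?_).trans
      card_image_le) (le_max_left _ _)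
    intro e he
    obtain ⟨heH, u, hu, rfl | rfl⟩ := mem_filter.1 he
    · exact absurd ⟨u, hu, heH⟩ hA
    · exact mem_image_of_mem (fun y => insert y (q.map φ)) hu

/-- Either the triangle spans a union of components, or the edges meeting it are few. -/
theorem separated_or_card_le {W : Finset V} (hW : ∀ e ∈ H, e ⊆ W) :
    (∀ e ∈ H, e ⊆ univ.map φ ∨ Disjoint e (univ.map φ)) ∨
      ∃ Y : Finset V, Y ⊆ W \ univ.map φ ∧ 1 ≤ #Y ∧
        #H ≤ 11 + 3 * max #Y 2 + #(H.filter (· ⊆ (W \ univ.map φ) \ Y)) := by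
  by_cases hsep : ∀ e ∈ H, e ⊆ univ.map φ ∨ Disjoint e (univ.map φ)
  · exact Or.inl hsep
  right
  push Not at hsep
  obtain ⟨e₀, he₀, hs₀, hd₀⟩ := hsep
  set U := univ.map φ with hU
  obtain ⟨p₀, hp₀, y₀, hy₀, rfl⟩ := crossing_edge h3 hP φ hφ he₀ hs₀ hd₀
  set Y := (W \ U).filter fun y => ∃ p ∈ netPairs, insert y (p.map φ) ∈ H with hYdef
  have hYU : ∀ y ∈ Y, y ∉ U := fun y hy => (mem_sdiff.1 (mem_filter.1 hy).1).2
  have hmemY : ∀ p ∈ netPairs, ∀ y, y ∉ U → insert y (p.map φ) ∈ H → y ∈ Y := fun p hp y hy h =>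
    mem_filter.2 ⟨mem_sdiff.2 ⟨hW _ h (mem_insert_self _ _), hy⟩, p, hp, h⟩
  refine ⟨Y, filter_subset _ _, card_pos.2 ⟨y₀, hmemY p₀ hp₀ y₀ hy₀ he₀⟩, ?_⟩
  have h11 := card_inside_le h3 hP φ hφ hp₀ hy₀ he₀
  rw [← hU] at h11
  have c1 := card_crossing_pair_le hP φ hφ (p := {0, 3}) (q := {2, 4}) (by simp) hYU
  have c2 := card_crossing_pair_le hP φ hφ (p := {2, 5}) (q := {0, 4}) (by simp) hYU
  have c3 := card_crossing_pair_le hP φ hφ (p := {1, 4}) (q := {0, 2}) (by simp) hYU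
  set F := fun p q : Finset (Fin 6) =>
    H.filter fun e => ∃ y ∈ Y, e = insert y (p.map φ) ∨ e = insert y (q.map φ) with hF
  have hcov : H ⊆ H.filter (· ⊆ U) ∪ (F {0, 3} {2, 4} ∪ F {2, 5} {0, 4} ∪ F {1, 4} {0, 2}) ∪
      H.filter (· ⊆ (W \ U) \ Y) := by
    intro e he
    by_cases hs : e ⊆ U
    · exact mem_union_left _ (mem_union_left _ (mem_filter.2 ⟨he, hs⟩))
    by_cases hd : Disjoint e U
    · refine mem_union_right _ (mem_filter.2 ⟨he, fun z hz => mem_sdiff.2 ⟨mem_sdiff.2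
        ⟨hW e he hz, disjoint_left.1 hd hz⟩, fun hzY => ?_⟩⟩)
      obtain ⟨-, p, hp, hpH⟩ := mem_filter.1 hzY
      exact crossing_disjoint hP φ hφ hp (hYU z hzY) hpH he hd hz
    · obtain ⟨p, hp, y, hy, rfl⟩ := crossing_edge h3 hP φ hφ he hs hd
      have hyY := hmemY p hp y hy he
      refine mem_union_left _ (mem_union_right _ ?_)
      simp only [netPairs, mem_insert, mem_singleton] at hp
      simp only [hF, mem_union, mem_filter]
      rcases hp with rfl | rfl | rfl | rfl | rfl | rfl
      · exact Or.inl (Or.inl ⟨he, y, hyY, Or.inl rfl⟩)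
      · exact Or.inl (Or.inl ⟨he, y, hyY, Or.inr rfl⟩)
      · exact Or.inl (Or.inr ⟨he, y, hyY, Or.inl rfl⟩)
      · exact Or.inl (Or.inr ⟨he, y, hyY, Or.inr rfl⟩)
      · exact Or.inr ⟨he, y, hyY, Or.inl rfl⟩
      · exact Or.inr ⟨he, y, hyY, Or.inr rfl⟩
  have h1 := card_le_card hcov
  have h2 := card_union_le (H.filter (· ⊆ U) ∪ (F {0, 3} {2, 4} ∪ F {2, 5} {0, 4} ∪
    F {1, 4} {0, 2})) (H.filter (· ⊆ (W \ U) \ Y))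
  have h4 := card_union_le (H.filter (· ⊆ U)) (F {0, 3} {2, 4} ∪ F {2, 5} {0, 4} ∪ F {1, 4} {0, 2})
  have h5 := card_union_le (F {0, 3} {2, 4} ∪ F {2, 5} {0, 4}) (F {1, 4} {0, 2})
  have h6 := card_union_le (F {0, 3} {2, 4}) (F {2, 5} {0, 4})
  change #(F {0, 3} {2, 4}) ≤ _ at c1
  change #(F {2, 5} {0, 4}) ≤ _ at c2
  change #(F {1, 4} {0, 2}) ≤ _ at c3
  omega

end

end Triangle

/-! ### Isomorphism, pullbacks and attainment of the Turán number -/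

section Transport

variable {k : ℕ} {U V W : Type*}

theorem Isomorphic.symm {H : KGraph k V} {G : KGraph k W} (h : H.Isomorphic G) :
    G.Isomorphic H := by
  obtain ⟨f, hf⟩ := h
  refine ⟨f.symm, fun e => ?_⟩
  rw [hf, map_map]
  have : f.symm.toEmbedding.trans f.toEmbedding = Function.Embedding.refl W := by ext; simp
  rw [this, map_refl]

theorem Isomorphic.trans {H : KGraph k U} {G : KGraph k V} {K : KGraph k W}
    (h : H.Isomorphic G) (h' : G.Isomorphic K) : H.Isomorphic K := by
  obtain ⟨f, hf⟩ := h
  obtain ⟨g, hg⟩ := h'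
  exact ⟨f.trans g, fun e => by rw [hf, hg, map_map]; rfl⟩

theorem Isomorphic.card_le {H : KGraph k V} {G : KGraph k W} (h : H.Isomorphic G) :
    #H.edges ≤ #G.edges := by
  obtain ⟨f, hf⟩ := h
  rw [← card_map (mapEmbedding f.toEmbedding).toEmbedding]
  refine card_le_card fun e he => ?_
  obtain ⟨S, hS, rfl⟩ := mem_map.1 he
  exact (hf S).1 hS

theorem Isomorphic.card_eq {H : KGraph k V} {G : KGraph k W} (h : H.Isomorphic G) :
    #H.edges = #G.edges :=
  le_antisymm h.card_le h.symm.card_le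

theorem Contains.of_isomorphic {H : KGraph k V} {G : KGraph k W} {F : KGraph k U}
    (hc : H.Contains F) (h : H.Isomorphic G) : G.Contains F := by
  obtain ⟨φ, hφ⟩ := hc
  obtain ⟨f, hf⟩ := h
  refine ⟨φ.trans f.toEmbedding, fun e he => ?_⟩
  rw [← map_map]
  exact (hf _).1 (hφ e he)

theorem Free.of_isomorphic {H : KGraph k V} {G : KGraph k W} {F : KGraph k U}
    (hc : H.Free F) (h : H.Isomorphic G) : G.Free F :=
  fun hG => hc (hG.of_isomorphic h.symm)

/-- The edge map is injective, so the cardinality bound makes it onto the edges of `G`; only one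
direction has to be checked afterwards. -/
theorem isomorphic_of_map_mem {H : KGraph k V} {G : KGraph k W} (f : V ≃ W)
    (hf : ∀ e ∈ H.edges, e.map f.toEmbedding ∈ G.edges) (hc : #G.edges ≤ #H.edges) :
    H.Isomorphic G := by
  have heq : H.edges.map (mapEmbedding f.toEmbedding).toEmbedding = G.edges := by
    refine eq_of_subset_of_card_le (fun e he => ?_) (by rwa [card_map])
    obtain ⟨S, hS, rfl⟩ := mem_map.1 he
    exact hf S hS
  refine ⟨f, fun e => ⟨hf e, fun he => ?_⟩⟩
  rw [← heq] at he
  obtain ⟨S, hS, h⟩ := mem_map.1 he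
  have : S = e := map_injective f.toEmbedding h
  exact this ▸ hS

/-- The `k`-graph on `V` whose edges are the preimages of the members of `H` under `ψ`. -/
def pullback [Fintype V] [DecidableEq W] (H : Finset (Finset W)) (h : ∀ e ∈ H, #e = k)
    (ψ : V ↪ W) : KGraph k V where
  edges := univ.filter fun S => S.map ψ ∈ H
  uniform := fun S hS => by
    rw [← card_map ψ]
    exact h _ (mem_filter.1 hS).2

theorem mem_pullback [Fintype V] [DecidableEq W] {H : Finset (Finset W)} {h : ∀ e ∈ H, #e = k}
    {ψ : V ↪ W} {S : Finset V} : S ∈ (pullback H h ψ).edges ↔ S.map ψ ∈ H := by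
  simp [pullback]

theorem card_pullback [Fintype V] [DecidableEq W] (H : Finset (Finset W)) (h : ∀ e ∈ H, #e = k)
    (ψ : V ↪ W) : #(pullback H h ψ).edges = #(H.filter (· ⊆ univ.map ψ)) := by
  rw [← card_map (mapEmbedding ψ).toEmbedding]
  congr 1
  ext e
  simp only [mem_map, mem_pullback, mem_filter]
  constructor
  · rintro ⟨S, hS, rfl⟩
    exact ⟨hS, map_subset_map.2 (subset_univ S)⟩
  · rintro ⟨he, hs⟩
    obtain ⟨S, -, rfl⟩ := subset_map_iff.1 hs
    exact ⟨S, he, rfl⟩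

theorem exists_isomorphic_fin [Fintype V] [DecidableEq V] (K : KGraph k V) {n : ℕ}
    (hn : Fintype.card V = n) : ∃ H : KGraph k (Fin n), H.Isomorphic K :=
  ⟨pullback K.edges K.uniform (Fintype.equivFinOfCardEq hn).symm.toEmbedding,
    (Fintype.equivFinOfCardEq hn).symm, fun _ => mem_pullback⟩

theorem le_ex {n : ℕ} {F : KGraph k W} {H : KGraph k (Fin n)} (h : H.Free F) :
    #H.edges ≤ ex n F :=
  le_csSup ⟨n.choose k, by rintro m ⟨H, -, rfl⟩; exact H.card_edges_le⟩ ⟨H, h, rfl⟩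

theorem le_ex_of_free [Fintype V] [DecidableEq V] {n : ℕ} (hn : Fintype.card V = n)
    {F : KGraph k W} {K : KGraph k V} (h : K.Free F) : #K.edges ≤ ex n F := by
  obtain ⟨H, hH⟩ := K.exists_isomorphic_fin hn
  rw [← hH.card_eq]
  exact le_ex (h.of_isomorphic hH.symm)

theorem exists_isExtremal (n : ℕ) {F : KGraph k W} (hF : F.edges.Nonempty) :
    ∃ H : KGraph k (Fin n), H.IsExtremal F := by
  have hne : {m : ℕ | ∃ H : KGraph k (Fin n), H.Free F ∧ H.edges.card = m}.Nonempty := by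
    -- The empty graph is `F`-free because `F` has an edge.
    refine ⟨0, ⟨∅, by simp⟩, ?_, rfl⟩
    rintro ⟨φ, hφ⟩
    obtain ⟨e, he⟩ := hF
    simpa using hφ e he
  exact Nat.sSup_mem hne ⟨n.choose k, by rintro m ⟨H, -, rfl⟩; exact H.card_edges_le⟩

theorem ex_le {n b : ℕ} {F : KGraph k W} (hF : F.edges.Nonempty)
    (h : ∀ H : KGraph k (Fin n), H.Free F → #H.edges ≤ b) : ex n F ≤ b := by
  obtain ⟨H, hf, hc⟩ := exists_isExtremal n hF
  rw [← hc]
  exact h H hf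

end Transport

/-! ### Disjoint unions -/

section DisjointUnion

variable {k : ℕ} {V W U : Type*} [DecidableEq V] [DecidableEq W]

theorem mem_disjointUnion {H : KGraph k V} {G : KGraph k W} {e : Finset (V ⊕ W)} :
    e ∈ (H.disjointUnion G).edges ↔ (∃ S ∈ H.edges, S.map Function.Embedding.inl = e) ∨
      ∃ S ∈ G.edges, S.map Function.Embedding.inr = e := by
  simp [disjointUnion]

theorem card_disjointUnion {H : KGraph k V} {G : KGraph k W} (hk : k ≠ 0) :
    #(H.disjointUnion G).edges = #H.edges + #G.edges := by
  unfold disjointUnion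
  rw [card_union_of_disjoint, card_image_of_injective _ (map_injective _),
    card_image_of_injective _ (map_injective _)]
  rw [disjoint_left]
  intro e he he'
  obtain ⟨S, hS, rfl⟩ := mem_image.1 he
  obtain ⟨T, hT, h⟩ := mem_image.1 he'
  obtain ⟨t, ht⟩ : T.Nonempty := card_pos.1 (by rw [G.uniform T hT]; omega)
  have : Sum.inr t ∈ S.map (Function.Embedding.inl : V ↪ V ⊕ W) := by
    rw [← h]; exact mem_map_of_mem _ ht
  simp at this

theorem Contains.disjointUnion {H : KGraph k V} {F : KGraph k U} (h : H.Contains F)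
    (G : KGraph k W) : (H.disjointUnion G).Contains F := by
  obtain ⟨φ, hφ⟩ := h
  refine ⟨φ.trans Function.Embedding.inl, fun e he => mem_disjointUnion.2 (Or.inl ⟨_, hφ e he, ?_⟩)⟩
  rw [map_map]

theorem Isomorphic.disjointUnion_right (H : KGraph k V) {G G' : KGraph k W}
    (h : G.Isomorphic G') (hk : k ≠ 0) : (H.disjointUnion G).Isomorphic (H.disjointUnion G') := by
  have hc := h.card_eq
  obtain ⟨f, hf⟩ := h
  refine isomorphic_of_map_mem ((Equiv.refl V).sumCongr f) (fun e he => ?_)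
    (by rw [card_disjointUnion hk, card_disjointUnion hk, hc])
  rcases mem_disjointUnion.1 he with ⟨S, hS, rfl⟩ | ⟨S, hS, rfl⟩
  · exact mem_disjointUnion.2 (Or.inl ⟨S, hS, by rw [map_map]; rfl⟩)
  · exact mem_disjointUnion.2 (Or.inr ⟨_, (hf S).1 hS, by rw [map_map, map_map]; rfl⟩)

end DisjointUnion

/-! ### Intersection sizes versus embedded copies; values and bounds for `ex` -/

section Bridge

variable {V W : Type*} [DecidableEq V] [DecidableEq W]

set_option maxHeartbeats 1000000 in
theorem linPathFree_of_free {H : KGraph 3 V} (h : H.Free linearPath3) : LinPathFree H.edges := by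
  intro e he f hf g hg h1 h2 h4
  apply h
  obtain ⟨r, hr⟩ := card_eq_one.1 h1
  obtain ⟨t, ht⟩ := card_eq_one.1 h2
  rw [card_eq_zero] at h4
  have hr' : r ∈ e ∩ f := by simp [hr]
  have ht' : t ∈ f ∩ g := by simp [ht]
  have hd : ∀ z, z ∈ e → z ∈ g → False := fun z h h' => by
    have : z ∈ e ∩ g := mem_inter.2 ⟨h, h'⟩
    simp [h4] at this
  have hef : ∀ z, z ∈ e → z ∈ f → z = r := fun z h h' => by
    have : z ∈ e ∩ f := mem_inter.2 ⟨h, h'⟩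
    simpa [hr] using this
  have hfg : ∀ z, z ∈ f → z ∈ g → z = t := fun z h h' => by
    have : z ∈ f ∩ g := mem_inter.2 ⟨h, h'⟩
    simpa [ht] using this
  rw [mem_inter] at hr' ht'
  have hrt : r ≠ t := by rintro rfl; exact hd r hr'.1 ht'.2
  obtain ⟨s, rfl, hrs, hts⟩ := triple_with_pair (H.uniform f hf) hrt hr'.2 ht'.1
  obtain ⟨p, q, rfl, hrp, hrq, hpq⟩ := triple_with_vertex (H.uniform e he) hr'.1
  obtain ⟨u, v, rfl, htu, htv, huv⟩ := triple_with_vertex (H.uniform g hg) ht'.2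
  simp only [mem_insert, mem_singleton] at hd hef hfg
  have hnd : Function.Injective ![p, q, r, s, t, u, v] := by
    rw [← List.nodup_ofFn]
    simp [List.ofFn_succ]
    grind
  refine ⟨⟨_, hnd⟩, fun S hS => ?_⟩
  simp only [linearPath3, mem_insert, mem_singleton] at hS
  rcases hS with rfl | rfl | rfl
  · convert he using 1; ext z; simp; tauto
  · convert hf using 1; ext z; simp; tauto
  · convert hg using 1; ext z; simp

theorem free_of_linPathFree {H : KGraph 3 V} (h : LinPathFree H.edges) : H.Free linearPath3 := by
  rintro ⟨φ, hφ⟩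
  refine h _ (hφ {0, 1, 2} (by simp [linearPath3])) _ (hφ {2, 3, 4} (by simp [linearPath3])) _
    (hφ {4, 5, 6} (by simp [linearPath3])) ?_ ?_ ?_ <;>
  · rw [card_map_inter_map]; decide

set_option maxHeartbeats 1000000 in
theorem linTriangleFree_of_free {H : KGraph 3 V} (h : H.Free triangle3) :
    LinTriangleFree H.edges := by
  intro e he f hf g hg h1 h2 h4 h5
  apply h
  obtain ⟨r, hr⟩ := card_eq_one.1 h1
  obtain ⟨t, ht⟩ := card_eq_one.1 h2
  obtain ⟨p, hp⟩ := card_eq_one.1 h4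
  rw [card_eq_zero] at h5
  have hr' : r ∈ e ∩ f := by simp [hr]
  have ht' : t ∈ f ∩ g := by simp [ht]
  have hp' : p ∈ e ∩ g := by simp [hp]
  have hd : ∀ z, z ∈ e → z ∈ f → z ∈ g → False := fun z h h' h'' => by
    have : z ∈ e ∩ f ∩ g := mem_inter.2 ⟨mem_inter.2 ⟨h, h'⟩, h''⟩
    simp [h5] at this
  have hef : ∀ z, z ∈ e → z ∈ f → z = r := fun z h h' => by
    have : z ∈ e ∩ f := mem_inter.2 ⟨h, h'⟩
    simpa [hr] using this
  have hfg : ∀ z, z ∈ f → z ∈ g → z = t := fun z h h' => by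
    have : z ∈ f ∩ g := mem_inter.2 ⟨h, h'⟩
    simpa [ht] using this
  have heg : ∀ z, z ∈ e → z ∈ g → z = p := fun z h h' => by
    have : z ∈ e ∩ g := mem_inter.2 ⟨h, h'⟩
    simpa [hp] using this
  rw [mem_inter] at hr' ht' hp'
  have hrt : r ≠ t := by rintro rfl; exact hd r hr'.1 hr'.2 ht'.2
  have hpr : p ≠ r := by rintro rfl; exact hd p hp'.1 hr'.2 hp'.2
  have htp : t ≠ p := by rintro rfl; exact hd t hp'.1 ht'.1 ht'.2
  obtain ⟨s, rfl, hrs, hts⟩ := triple_with_pair (H.uniform f hf) hrt hr'.2 ht'.1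
  obtain ⟨q, rfl, hpq, hrq⟩ := triple_with_pair (H.uniform e he) hpr hp'.1 hr'.1
  obtain ⟨u, rfl, htu, hpu⟩ := triple_with_pair (H.uniform g hg) htp ht'.2 hp'.2
  simp only [mem_insert, mem_singleton] at hd hef hfg heg
  have hnd : Function.Injective ![p, q, r, s, t, u] := by
    rw [← List.nodup_ofFn]
    simp [List.ofFn_succ]
    grind
  refine ⟨⟨_, hnd⟩, fun S hS => ?_⟩
  simp only [triangle3, mem_insert, mem_singleton] at hS
  rcases hS with rfl | rfl | rfl
  · convert he using 1; ext z; simp; tauto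
  · convert hf using 1; ext z; simp; tauto
  · convert hg using 1; ext z; simp; tauto

theorem LinPathFree.mono {H H' : Finset (Finset V)} (h : LinPathFree H) (hs : H' ⊆ H) :
    LinPathFree H' :=
  fun e he f hf g hg => h e (hs he) f (hs hf) g (hs hg)

theorem free_pullback {α : Type*} [Fintype α] [DecidableEq α] {H : Finset (Finset V)}
    (h : ∀ e ∈ H, #e = 3) (hP : LinPathFree H) (ψ : α ↪ V) :
    (pullback H h ψ).Free linearPath3 := by
  refine free_of_linPathFree fun e he f hf g hg h1 h2 h4 => ?_
  exact hP _ (mem_pullback.1 he) _ (mem_pullback.1 hf) _ (mem_pullback.1 hg)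
    (by rwa [card_map_inter_map]) (by rwa [card_map_inter_map]) (by rwa [card_map_inter_map])

theorem linearPath3_nonempty : linearPath3.edges.Nonempty := ⟨{0, 1, 2}, by simp [linearPath3]⟩

/-- An enumeration of the members of `W`. -/
noncomputable def finsetEmb (W : Finset V) {k : ℕ} (hk : #W = k) : Fin k ↪ V :=
  (W.equivFinOfCardEq hk).symm.toEmbedding.trans (Function.Embedding.subtype _)

omit [DecidableEq V] in
theorem map_finsetEmb (W : Finset V) {k : ℕ} (hk : #W = k) : univ.map (finsetEmb W hk) = W := by
  ext z
  simp only [mem_map, mem_univ, true_and, finsetEmb]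
  constructor
  · rintro ⟨i, rfl⟩; exact ((W.equivFinOfCardEq hk).symm i).2
  · intro hz; exact ⟨W.equivFinOfCardEq hk ⟨z, hz⟩, by simp⟩

theorem card_filter_subset_le_ex {H : Finset (Finset V)} (h : ∀ e ∈ H, #e = 3)
    (hP : LinPathFree H) (W : Finset V) : #(H.filter (· ⊆ W)) ≤ ex #W linearPath3 := by
  have h1 := le_ex (free_pullback h hP (finsetEmb W rfl))
  rwa [card_pullback, map_finsetEmb] at h1

/-- Consecutive edges of a path intersect, so all three lie on the same side. -/
theorem free_disjointUnion {H : KGraph 3 V} {G : KGraph 3 W} (hH : H.Free linearPath3)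
    (hG : G.Free linearPath3) : (H.disjointUnion G).Free linearPath3 := by
  have hH := linPathFree_of_free hH
  have hG := linPathFree_of_free hG
  have hlr : ∀ (S : Finset V) (T : Finset W),
      #(S.map Function.Embedding.inl ∩ T.map (Function.Embedding.inr : W ↪ V ⊕ W)) = 0 := by
    intro S T
    rw [card_eq_zero]
    ext z
    cases z <;> simp
  refine free_of_linPathFree fun e he f hf g hg h1 h2 h4 => ?_
  rcases mem_disjointUnion.1 he with ⟨S, hS, rfl⟩ | ⟨S, hS, rfl⟩ <;>
  rcases mem_disjointUnion.1 hf with ⟨T, hT, rfl⟩ | ⟨T, hT, rfl⟩ <;>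
  rcases mem_disjointUnion.1 hg with ⟨R, hR, rfl⟩ | ⟨R, hR, rfl⟩ <;>
  first
  | (rw [card_map_inter_map] at h1 h2 h4; first | exact hH S hS T hT R hR h1 h2 h4 | exact hG S hS T hT R hR h1 h2 h4)
  | (rw [hlr] at h1; omega)
  | (rw [hlr] at h2; omega)
  | (rw [inter_comm, hlr] at h1; omega)
  | (rw [inter_comm, hlr] at h2; omega)

theorem ex_add_le (a b : ℕ) :
    ex a linearPath3 + ex b linearPath3 ≤ ex (a + b) linearPath3 := by
  obtain ⟨H, hH, hH'⟩ := exists_isExtremal a linearPath3_nonempty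
  obtain ⟨G, hG, hG'⟩ := exists_isExtremal b linearPath3_nonempty
  rw [← hH', ← hG', ← card_disjointUnion (by norm_num)]
  exact le_ex_of_free (by simp) (free_disjointUnion hH hG)

theorem free_complete {n : ℕ} (hn : n ≤ 6) : (complete 3 n).Free linearPath3 := by
  rintro ⟨φ, -⟩
  have := Fintype.card_le_of_embedding φ
  simp at this
  omega

theorem card_complete (k n : ℕ) : #(complete k n).edges = n.choose k := by
  simp [complete]

theorem ex_eq_choose {n : ℕ} (hn : n ≤ 6) : ex n linearPath3 = n.choose 3 := by
  refine le_antisymm (ex_le linearPath3_nonempty fun H _ => H.card_edges_le) ?_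
  rw [← card_complete]
  exact le_ex (free_complete hn)

/-- The full star with centre `x`. -/
def star {n : ℕ} (x : Fin n) : KGraph 3 (Fin n) where
  edges := (powersetCard 3 univ).filter (x ∈ ·)
  uniform := fun _ he => (mem_powersetCard.1 (mem_filter.1 he).1).2

theorem card_star {n : ℕ} (x : Fin n) : #(star x).edges = (n - 1).choose 2 := by
  have : (star x).edges = (powersetCard 2 (univ.erase x)).image (insert x) := by
    ext e
    simp only [star, mem_filter, mem_powersetCard, mem_image, subset_univ, true_and]
    constructor
    · rintro ⟨h1, h2⟩
      exact ⟨e.erase x, ⟨erase_subset_erase _ (subset_univ _), by rw [card_erase_of_mem h2, h1]⟩,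
        insert_erase h2⟩
    · rintro ⟨S, ⟨hS, hc⟩, rfl⟩
      have hx : x ∉ S := fun h => by simpa using hS h
      exact ⟨by rw [card_insert_of_notMem hx, hc], mem_insert_self _ _⟩
  rw [this, card_image_of_injOn, card_powersetCard, card_erase_of_mem (mem_univ _)]
  · simp
  · intro S hS T hT hST
    have hS' : x ∉ S := fun h => by simpa using (mem_powersetCard.1 hS).1 h
    have hT' : x ∉ T := fun h => by simpa using (mem_powersetCard.1 hT).1 h
    have h : insert x S = insert x T := hST
    rw [← erase_insert hS', h, erase_insert hT']

theorem free_star {n : ℕ} (x : Fin n) : (star x).Free linearPath3 := by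
  refine free_of_linPathFree fun e he f _ g hg _ _ h => ?_
  have : x ∈ e ∩ g := mem_inter.2 ⟨(mem_filter.1 he).2, (mem_filter.1 hg).2⟩
  rw [card_eq_zero] at h
  simp [h] at this

theorem isomorphic_star {n : ℕ} (x y : Fin n) : (star x).Isomorphic (star y) := by
  refine isomorphic_of_map_mem (Equiv.swap x y) (fun e he => ?_) (by rw [card_star, card_star])
  obtain ⟨h1, h2⟩ := mem_filter.1 he
  refine mem_filter.2 ⟨mem_powersetCard.2 ⟨subset_univ _, ?_⟩, ?_⟩
  · rw [card_map]; exact (mem_powersetCard.1 h1).2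
  · exact mem_map.2 ⟨x, h2, by simp⟩

theorem choose_le_ex {n : ℕ} (hn : 1 ≤ n) : (n - 1).choose 2 ≤ ex n linearPath3 := by
  rw [← card_star (⟨0, hn⟩ : Fin n)]
  exact le_ex (free_star _)

/-- Complete graphs suffice for `t ≤ 6` and stars beyond. The margin is a single edge at `t = 3` and
`t = 4`. -/
theorem crossing_bound_lt {t : ℕ} (ht : 1 ≤ t) : 11 + 3 * max t 2 < 20 + ex t linearPath3 := by
  by_cases h6 : t ≤ 6
  · rw [ex_eq_choose h6]
    interval_cases t <;> decide
  · have h1 := choose_le_ex ht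
    obtain ⟨s, rfl⟩ : ∃ s, t = s + 7 := ⟨t - 7, by omega⟩
    have h2 := two_mul_choose_two (s + 5)
    have h3 : s + 7 - 1 = s + 5 + 1 := by omega
    rw [h3] at h1
    have : max (s + 7) 2 = s + 7 := by omega
    rw [this]
    nlinarith

end Bridge

/-! ### Graphs containing a triangle, and uniqueness of extremal graphs -/

/-- In a path-free 3-graph containing a triangle with at least `20 + ex (n - 6)` edges, the triangle
spans a union of components. -/
theorem exists_separated {n : ℕ} {H : KGraph 3 (Fin n)} (hP : H.Free linearPath3)
    (hT : H.Contains triangle3) (hc : 20 + ex (n - 6) linearPath3 ≤ #H.edges) :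
    ∃ U : Finset (Fin n), #U = 6 ∧ ∀ e ∈ H.edges, e ⊆ U ∨ Disjoint e U := by
  obtain ⟨φ, hφ⟩ := hT
  have hP := linPathFree_of_free hP
  refine ⟨univ.map φ, by simp, ?_⟩
  rcases separated_or_card_le H.uniform hP φ hφ (W := univ) (fun e _ => subset_univ e) with
    h | ⟨Y, hY, h1, h2⟩
  · exact h
  · exfalso
    have h4 := card_filter_subset_le_ex H.uniform hP ((univ \ univ.map φ) \ Y)
    have h5 : #(univ \ univ.map φ) = n - 6 := by
      rw [card_sdiff_of_subset (subset_univ _)]; simp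
    have h6 : #((univ \ univ.map φ) \ Y) = n - 6 - #Y := by
      rw [card_sdiff_of_subset hY, h5]
    have h7 : #Y ≤ n - 6 := h5 ▸ card_le_card hY
    -- Superadditivity lets the `ex #Y` edges that could be placed on `Y` outweigh everything gained
    -- by crossing.
    have h8 := ex_add_le (#Y) (n - 6 - #Y)
    rw [Nat.add_sub_cancel' h7] at h8
    rw [h6] at h4
    have h9 := crossing_bound_lt h1
    omega

theorem card_le_inside_add_outside {n : ℕ} {H : KGraph 3 (Fin n)} (hP : H.Free linearPath3)
    {U : Finset (Fin n)} (hU : #U = 6) (hs : ∀ e ∈ H.edges, e ⊆ U ∨ Disjoint e U) :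
    #H.edges ≤ #(H.edges.filter (· ⊆ U)) + #(H.edges.filter (· ⊆ Uᶜ)) ∧
      #(H.edges.filter (· ⊆ U)) ≤ 20 ∧
      #(H.edges.filter (· ⊆ Uᶜ)) ≤ ex (n - 6) linearPath3 := by
  refine ⟨?_, ?_, ?_⟩
  · refine (card_le_card fun e he => ?_).trans (card_union_le _ _)
    rcases hs e he with h | h
    · exact mem_union_left _ (mem_filter.2 ⟨he, h⟩)
    · exact mem_union_right _ (mem_filter.2 ⟨he, subset_compl_iff_disjoint_right.2 h⟩)
  · refine (card_le_card (t := powersetCard 3 U) fun e he => ?_).trans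
      (by rw [card_powersetCard, hU]; decide)
    exact mem_powersetCard.2 ⟨(mem_filter.1 he).2, H.uniform e (mem_filter.1 he).1⟩
  · have := card_filter_subset_le_ex H.uniform (linPathFree_of_free hP) Uᶜ
    rwa [card_compl, hU, Fintype.card_fin] at this

theorem card_le_of_contains {n : ℕ} {H : KGraph 3 (Fin n)} (hP : H.Free linearPath3)
    (hT : H.Contains triangle3) : #H.edges ≤ 20 + ex (n - 6) linearPath3 := by
  by_contra! hc
  obtain ⟨U, hU, hs⟩ := exists_separated hP hT hc.le
  have := card_le_inside_add_outside hP hU hs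
  omega

theorem isomorphic_disjointUnion {n : ℕ} {H : KGraph 3 (Fin n)} (hP : H.Free linearPath3)
    (hT : H.Contains triangle3) (hc : #H.edges = 20 + ex (n - 6) linearPath3)
    {G : KGraph 3 (Fin (n - 6))}
    (hG : ∀ G' : KGraph 3 (Fin (n - 6)), G'.IsExtremal linearPath3 → G'.Isomorphic G) :
    H.Isomorphic ((complete 3 6).disjointUnion G) := by
  obtain ⟨U, hU, hs⟩ := exists_separated hP hT hc.ge
  obtain ⟨h1, h2, h3⟩ := card_le_inside_add_outside hP hU hs
  have hUc : #Uᶜ = n - 6 := by rw [card_compl, hU, Fintype.card_fin]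
  -- The total is the sum of the two upper bounds, so both are attained.
  have hin : H.edges.filter (· ⊆ U) = powersetCard 3 U := by
    refine eq_of_subset_of_card_le (fun e he => ?_) ?_
    · exact mem_powersetCard.2 ⟨(mem_filter.1 he).2, H.uniform e (mem_filter.1 he).1⟩
    · rw [card_powersetCard, hU]
      have : Nat.choose 6 3 = 20 := by decide
      omega
  set G' := pullback H.edges H.uniform (finsetEmb Uᶜ hUc) with hG'
  have hG'card : #G'.edges = ex (n - 6) linearPath3 := by
    rw [hG', card_pullback, map_finsetEmb]; omega
  have hiso := hG G' ⟨free_pullback H.uniform (linPathFree_of_free hP) _, hG'card⟩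
  refine Isomorphic.trans (Isomorphic.symm ?_) (hiso.disjointUnion_right (complete 3 6)
    (by norm_num))
  have hmU : ∀ i, finsetEmb U hU i ∈ U := fun i => by
    have : finsetEmb U hU i ∈ univ.map (finsetEmb U hU) := mem_map_of_mem _ (mem_univ i)
    rwa [map_finsetEmb] at this
  have hmUc : ∀ i, finsetEmb Uᶜ hUc i ∉ U := fun i => by
    have : finsetEmb Uᶜ hUc i ∈ univ.map (finsetEmb Uᶜ hUc) := mem_map_of_mem _ (mem_univ i)
    rw [map_finsetEmb] at this
    exact mem_compl.1 this
  have hbij : Function.Bijective (Sum.elim (finsetEmb U hU) (finsetEmb Uᶜ hUc)) := by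
    rw [Fintype.bijective_iff_injective_and_card]
    constructor
    · refine Function.Injective.sumElim (finsetEmb U hU).injective (finsetEmb Uᶜ hUc).injective ?_
      intro i j hij
      exact hmUc j (hij ▸ hmU i)
    · have := card_le_univ U
      simp only [Fintype.card_fin] at this
      simp
      omega
  refine isomorphic_of_map_mem (Equiv.ofBijective _ hbij) (fun e he => ?_) ?_
  · rcases mem_disjointUnion.1 he with ⟨S, hS, rfl⟩ | ⟨S, hS, rfl⟩
    · have hS3 := (mem_powersetCard.1 hS).2
      have hmem : S.map (finsetEmb U hU) ∈ powersetCard 3 U := by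
        refine mem_powersetCard.2 ⟨?_, by rw [card_map, hS3]⟩
        intro z hz
        obtain ⟨i, -, rfl⟩ := mem_map.1 hz
        exact hmU i
      rw [← hin] at hmem
      convert (mem_filter.1 hmem).1 using 1
      rw [map_map]
      rfl
    · convert mem_pullback.1 hS using 1
      rw [map_map]
      rfl
  · rw [card_disjointUnion (by norm_num), card_complete, hG'card, hc]
    rfl

theorem card_le_of_triangle_free {n : ℕ} {H : KGraph 3 (Fin n)} (hP : H.Free linearPath3)
    (hT : H.Free triangle3) (hn : 7 ≤ n) : #H.edges ≤ (n - 1).choose 2 :=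
  ((card_le_of_centerClosed n univ H.edges (by simp) H.uniform (fun e _ => subset_univ e)
    (centerClosed_of_free H.uniform (linPathFree_of_free hP) (linTriangleFree_of_free hT))).2 hn).1

theorem ex_one : ex 1 linearPath3 = 0 := by rw [ex_eq_choose (by norm_num)]; rfl

/-- The exceptional order: `K_6` with an isolated vertex beats the star, which has 15 edges. -/
theorem ex_seven : ex 7 linearPath3 = 20 := by
  refine le_antisymm (ex_le linearPath3_nonempty fun H hP => ?_) ?_
  · by_cases hT : H.Contains triangle3
    · have := card_le_of_contains hP hT
      rwa [show 7 - 6 = 1 from rfl, ex_one] at this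
    · exact (card_le_of_triangle_free hP hT le_rfl).trans (by decide)
  · have := ex_add_le 6 1
    rw [ex_eq_choose le_rfl, ex_one] at this
    exact this

/-- From 8 vertices on, a triangle is worse than a full star. The induction bounds `ex (n - 6)`
itself by a star; residual orders up to 7 are evaluated directly, since at 7 the star bound fails.
-/
theorem twenty_add_ex_lt : ∀ n : ℕ, 8 ≤ n → 20 + ex (n - 6) linearPath3 < (n - 1).choose 2 := by
  intro n
  induction n using Nat.strong_induction_on with
  | _ n ih =>
  intro hn
  obtain ⟨j, rfl⟩ : ∃ j, n = j + 6 := ⟨n - 6, by omega⟩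
  rw [Nat.add_sub_cancel, show j + 6 - 1 = j + 5 by omega]
  have hj2 : 2 ≤ j := by omega
  by_cases h6 : j ≤ 6
  · rw [ex_eq_choose h6]
    interval_cases j <;> decide
  by_cases h7 : j = 7
  · subst h7
    rw [ex_seven]
    decide
  have hj : 8 ≤ j := by omega
  have h1 : ex j linearPath3 ≤ (j - 1).choose 2 := by
    refine ex_le linearPath3_nonempty fun H hP => ?_
    by_cases hT : H.Contains triangle3
    · exact (card_le_of_contains hP hT).trans (ih j (by omega) hj).le
    · exact card_le_of_triangle_free hP hT (by omega)
  obtain ⟨s, rfl⟩ : ∃ s, j = s + 2 := ⟨j - 2, by omega⟩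
  have h2 := two_mul_choose_two s
  have h3 := two_mul_choose_two (s + 6)
  rw [show s + 2 - 1 = s + 1 by omega] at h1
  rw [show s + 2 + 5 = s + 6 + 1 by omega]
  nlinarith

/-- The path-free 3-graphs with the largest number of edges are unique up to isomorphism. -/
theorem exists_unique_extremal (m : ℕ) : ∃ G : KGraph 3 (Fin m), G.IsExtremal linearPath3 ∧
    ∀ G' : KGraph 3 (Fin m), G'.IsExtremal linearPath3 → G'.Isomorphic G := by
  have hsmall : ∀ m ≤ 6, (complete 3 m).IsExtremal linearPath3 ∧
      ∀ G' : KGraph 3 (Fin m), G'.IsExtremal linearPath3 → G'.Isomorphic (complete 3 m) := by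
    intro m h6
    refine ⟨⟨free_complete h6, by rw [card_complete, ex_eq_choose h6]⟩, fun G' hG' => ?_⟩
    refine isomorphic_of_map_mem (Equiv.refl _) (fun e he => ?_) ?_
    · refine mem_powersetCard.2 ⟨subset_univ _, ?_⟩
      rw [card_map, G'.uniform e he]
    · rw [card_complete, hG'.2, ex_eq_choose h6]
  by_cases h6 : m ≤ 6
  · exact ⟨_, hsmall m h6⟩
  by_cases h7 : m = 7
  · subst h7
    have hiso : ∀ G : KGraph 3 (Fin 7), G.IsExtremal linearPath3 →
        G.Isomorphic ((complete 3 6).disjointUnion (complete 3 1)) := by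
      rintro G ⟨hP, hc⟩
      rw [ex_seven] at hc
      have hT : G.Contains triangle3 := by
        by_contra hT
        have h1 := card_le_of_triangle_free hP hT le_rfl
        have h2 : (7 - 1).choose 2 = 15 := by decide
        omega
      -- The structure theorem for graphs with a triangle applies with a one-vertex remainder, whose
      -- uniqueness is already known.
      refine isomorphic_disjointUnion hP hT ?_ (hsmall 1 (by norm_num)).2
      rw [show 7 - 6 = 1 from rfl, ex_one, hc]
    obtain ⟨G, hG⟩ := exists_isExtremal 7 linearPath3_nonempty
    exact ⟨G, hG, fun G' hG' => (hiso G' hG').trans (hiso G hG).symm⟩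
  have hm : 8 ≤ m := by omega
  have hstar : ∀ G : KGraph 3 (Fin m), G.IsExtremal linearPath3 →
      ∃ x : Fin m, G.Isomorphic (star x) := by
    rintro G ⟨hP, hc⟩
    have hge := choose_le_ex (n := m) (by omega)
    have hT : G.Free triangle3 := by
      intro hT
      have h1 := card_le_of_contains hP hT
      have h2 := twenty_add_ex_lt m hm
      omega
    have hle := card_le_of_triangle_free hP hT (by omega)
    obtain ⟨x, -, hx⟩ := ((card_le_of_centerClosed m univ G.edges (by simp) G.uniform
      (fun e _ => subset_univ e) (centerClosed_of_free G.uniform (linPathFree_of_free hP)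
        (linTriangleFree_of_free hT))).2 (by omega)).2 hm (by omega)
    refine ⟨x, isomorphic_of_map_mem (Equiv.refl _) (fun e he => ?_) ?_⟩
    · refine mem_filter.2 ⟨mem_powersetCard.2 ⟨subset_univ _, ?_⟩, ?_⟩
      · rw [card_map, G.uniform e he]
      · exact mem_map.2 ⟨x, hx e he, rfl⟩
    · rw [card_star]; omega
  obtain ⟨G, hG⟩ := exists_isExtremal m linearPath3_nonempty
  refine ⟨G, hG, fun G' hG' => ?_⟩
  obtain ⟨x, hx⟩ := hstar G hG
  obtain ⟨y, hy⟩ := hstar G' hG'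
  exact hy.trans ((isomorphic_star y x).trans hx.symm)

theorem complete_contains_triangle : (complete 3 6).Contains triangle3 :=
  ⟨Function.Embedding.refl _, fun e he => mem_powersetCard.2
    ⟨subset_univ _, by rw [card_map, triangle3.uniform e he]⟩⟩

end KGraph

theorem theorem3 (n : ℕ) (hn : 6 ≤ n) :
    KGraph.exCond n KGraph.linearPath3 KGraph.triangle3
        = 20 + KGraph.ex (n - 6) KGraph.linearPath3 ∧
    ∃ G : KGraph 3 (Fin (n - 6)),
      G.IsExtremal KGraph.linearPath3 ∧
      (∀ G' : KGraph 3 (Fin (n - 6)), G'.IsExtremal KGraph.linearPath3 → G'.Isomorphic G) ∧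
      ∀ H : KGraph 3 (Fin n),
        H.IsCondExtremal KGraph.linearPath3 KGraph.triangle3 ↔
          H.Isomorphic ((KGraph.complete 3 6).disjointUnion G) := by
  obtain ⟨G, hG, hu⟩ := KGraph.exists_unique_extremal (n - 6)
  have hfree := KGraph.free_disjointUnion (KGraph.free_complete le_rfl) hG.1
  have hcont := KGraph.complete_contains_triangle.disjointUnion G
  have hcard : ((KGraph.complete 3 6).disjointUnion G).edges.card =
      20 + KGraph.ex (n - 6) KGraph.linearPath3 := by
    rw [KGraph.card_disjointUnion (by norm_num), KGraph.card_complete, hG.2]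
    rfl
  have hex : KGraph.exCond n KGraph.linearPath3 KGraph.triangle3
      = 20 + KGraph.ex (n - 6) KGraph.linearPath3 := by
    refine IsGreatest.csSup_eq ⟨?_, ?_⟩
    · obtain ⟨H, hH⟩ := ((KGraph.complete 3 6).disjointUnion G).exists_isomorphic_fin (n := n)
        (by simp; omega)
      exact ⟨H, hfree.of_isomorphic hH.symm, hcont.of_isomorphic hH.symm, hH.card_eq.trans hcard⟩
    · rintro m ⟨H, hP, hT, rfl⟩
      exact KGraph.card_le_of_contains hP hT
  refine ⟨hex, G, hG, hu, fun H => ⟨?_, fun hH => ?_⟩⟩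
  · rintro ⟨hP, hT, hc⟩
    exact KGraph.isomorphic_disjointUnion hP hT (hc.trans hex) hu
  · exact ⟨hfree.of_isomorphic hH.symm, hcont.of_isomorphic hH.symm,
      (hH.card_eq.trans hcard).trans hex.symm⟩
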